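/- Let $[n]=\{1,\dots,n\}$ and write $\log$ for the logarithm to base $2$. For $a=(a_1,\dots,a_n)\in[m]^n$ let $F_2(a)=\sum_{1\le i,j\le n}\mathbf 1[a_i=a_j]$. *The hash family $\mathcal H^{n,m,t,\kappa}$.* A sample $\mathbf h\sim\mathcal H^{n,m,t,\kappa}$ is obtained from independent random functions $\mathbf h_1,\dots,\mathbf h_t:[m]\to[n]\cup\{0\}$, where each $\mathbf h_i$ satisfies $\Pr[\mathbf h_i(j)=0]=\frac12$ and $\Pr[\mathbf h_i(j)=v]=\frac1{2n}$ for all $j\in[m]$, $v\in[n]$, and is $\kappa$-wise independent, that is, its values at any at most $\kappa$ distinct points of $[m]$ are mutually independent; apart from this the distributions of the $\mathbf h_i$ are arbitrary. Then $\mathbf h:[m]\to[n]\cup\{-1\}$ is defined by $\mathbf h(j)=\mathbf h_q(j)$ for the smallest $q\le t$ with $\mathbf h_q(j)\neq0$, and $\mathbf h(j)=-1$ if there is no such $q$. *The digraph.* For $a\in[m]^n$ and $h:[m]\to[n]\cup\{-1\}$, let $G_{a,h}$ be the digraph on $[n]$ with an edge $(x,h(a_x))$ for each $x\in[n]$ with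 $h(a_x)\ne-1$. For $A\subseteq[n]$ let $\mathsf{Out}_{a,h}(A)$ be the set of vertices reachable in $G_{a,h}$ by a directed path of length $\ge 0$ from at least one vertex of $A$. **Lemma.** There is an absolute constant $c>0$ with the following property. Let $n,m,k$ be integers with $1\le k\le n$, and let $t=\frac12\log(n/k)$ and $\kappa=20\log n$, each rounded to an integer in either direction (that is, $t,\kappa\ge0$ are integers with $|t-\frac12\log(n/k)|<1$ and $|\kappa-20\log n|<1$); if $k=1$, assume $t\ge1$. Let $\mathbf h\sim\mathcal H^{n,m,t,\kappa}$, and let $\mathbf x_1,\dots,\mathbf x_k$ be uniformly distributed on $[n]$, independent of each other and of $(\mathbf h_1,\dots,\mathbf h_t)$. Then for every $a\in[m]^n$ and all $u,v\in[n]$ with $u\ne v$, $$\Pr_{\mathbf h,(\mathbf x_i)}\big[u,v\in\mathsf{Out}_{a,\mathbf h}(\{\mathbf x_1,\dots,\mathbf x_k\})\big]\ \ge\ c\cdot\frac{k}{F_2(a)}.$$ -/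

import Mathlib

open MeasureTheory ProbabilityTheory

namespace LayeredHash

/-- The finite set `[n] ∪ {0}` (or `[n] ∪ {-1}`) is modelled by `Option (Fin n)`, the extra
symbol being `none`; it carries the discrete σ-algebra. -/
instance instMeasurableSpaceOptionFin (n : ℕ) : MeasurableSpace (Option (Fin n)) := ⊤

/-- The second frequency moment `∑_{i,j} 1[a_i = a_j]`. -/
def F2 {n m : ℕ} (a : Fin n → Fin m) : ℕ :=
  ∑ i : Fin n, ∑ j : Fin n, if a i = a j then 1 else 0

/-- `g` is a random function `[m] → [n] ∪ {0}` which takes, at every point, the value `0` with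
probability `1/2` and every `v ∈ [n]` with probability `1/(2n)`, and which is `κ`-wise independent:
its values at any at most `κ` distinct points are mutually independent. -/
structure IsLayer {Ω : Type*} [MeasurableSpace Ω] (μ : Measure Ω) {n m : ℕ} (κ : ℕ)
    (g : Ω → Fin m → Option (Fin n)) : Prop where
  measurable : Measurable g
  prob_none : ∀ j : Fin m, μ.real {ω | g ω j = none} = 1 / 2
  prob_some : ∀ (j : Fin m) (v : Fin n), μ.real {ω | g ω j = some v} = 1 / (2 * (n : ℝ))
  kwise : ∀ s : Finset (Fin m), s.card ≤ κ →
    iIndepFun (fun (j : s) (ω : Ω) => g ω (j : Fin m)) μ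

/-- The combined hash of the layers `g_1, …, g_t`: at `j` it is the first nonzero value among
`g_1(j), …, g_t(j)`, and `none` (the symbol `-1`) if there is no such value. -/
def combine {n m t : ℕ} (g : Fin t → Fin m → Option (Fin n)) (j : Fin m) : Option (Fin n) :=
  Fin.findSome? fun q => g q j

/-- The digraph `G_{a,f}` on `[n]`: there is an edge from `x` to `f (a x)` unless `f (a x)` is the
symbol `-1`. -/
def graph {n m : ℕ} (a : Fin n → Fin m) (f : Fin m → Option (Fin n)) : Digraph (Fin n) where
  Adj x y := f (a x) = some y

/-- The set of vertices reachable in `G_{a,f}` from at least one vertex of `A`, by a directed path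
of length `≥ 0`. -/
def Out {n m : ℕ} (a : Fin n → Fin m) (f : Fin m → Option (Fin n)) (A : Set (Fin n)) :
    Set (Fin n) :=
  {y | ∃ x ∈ A, Relation.ReflTransGen (graph a f).Adj x y}

/-- `h_1, …, h_t` are the independent layers of a sample from the hash family with parameters
`n, m, t, κ`, and `x_1, …, x_k` are independent uniform vertices, independent of the layers. -/
structure IsSample {Ω : Type*} [MeasurableSpace Ω] (μ : Measure Ω) {n m t k : ℕ} (κ : ℕ)
    (h : Fin t → Ω → Fin m → Option (Fin n)) (x : Fin k → Ω → Fin n) : Prop where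
  layer : ∀ i, IsLayer μ κ (h i)
  layers_indep : iIndepFun h μ
  start_measurable : ∀ i, Measurable (x i)
  start_uniform : ∀ (i : Fin k) (v : Fin n), μ.real {ω | x i ω = v} = 1 / (n : ℝ)
  starts_indep : iIndepFun x μ
  layers_starts_indep : IndepFun (fun ω i => h i ω) (fun ω i => x i ω) μ

end LayeredHash

namespace LayeredHash

/-- The possible values of one layer of the hash. -/
abbrev Layer (n m : ℕ) := Fin m → Option (Fin n)

/-- The fate of a vertex in a partial hash: `inl r` if its path stops at the undefined key `r`,
`inr 0` and `inr 1` if it reaches the first, resp. second, target, and `inr 2` if it is given up. -/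
abbrev Fate (m : ℕ) := Fin m ⊕ Fin 3

/-- The expectation functional of a `κ`-wise independent layer: a normalised positive functional
for which the value at a key is independent of any function of fewer than `κ` other keys. -/
structure IsKWise {n m : ℕ} (κ : ℕ) (E : (Layer n m → ℝ) →ₗ[ℝ] ℝ) : Prop where
  nonneg : ∀ F : Layer n m → ℝ, (∀ g, 0 ≤ F g) → 0 ≤ E F
  one : E (fun _ => 1) = 1
  fresh_none : ∀ (Q : Finset (Fin m)) (r : Fin m) (X : Layer n m → ℝ), Q.card < κ → r ∉ Q →
    DependsOn X (Q : Set (Fin m)) → E (fun g => X g * if g r = none then 1 else 0) = E X / 2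
  fresh_some : ∀ (Q : Finset (Fin m)) (r : Fin m) (X : Layer n m → ℝ) (y : Fin n), Q.card < κ →
    r ∉ Q → DependsOn X (Q : Set (Fin m)) →
      E (fun g => X g * if g r = some y then 1 else 0) = E X / (2 * n)

/-- Follow the layer `g`, with fuel `j` and visited keys `S`, from a vertex of given fate, where `R`
gives the fates before `g` is added. -/
def walk {n m : ℕ} (R : Fin n → Fate m) (g : Layer n m) :
    ℕ → Finset (Fin m) → Fate m → Fate m
  | _, _, .inr i => .inr i
  | 0, _, .inl _ => .inr 2
  | j + 1, S, .inl r =>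
    if r ∈ S then .inr 2
    else match g r with
      | none => .inl r
      | some y => walk R g j (insert r S) (R y)

section Average

variable {n m : ℕ} (R : Fin n → Fate m)

/-- The average of `f` over the fates of all vertices. -/
noncomputable def avg (f : Fate m → ℝ) : ℝ := (∑ y, f (R y)) / n

/-- The fraction of vertices with fate `c`. -/
noncomputable def mass (c : Fate m) : ℝ := avg R fun c' => if c' = c then 1 else 0

/-- Extension by zero of a function on keys to fates. -/
def keyFun (φ : Fin m → ℝ) : Fate m → ℝ := Sum.elim φ fun _ => 0

/-- The fraction of vertices whose path stops at a given key. -/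
noncomputable def keyMass (r : Fin m) : ℝ := mass R (.inl r)

/-- The probability that two random vertices stop at the same key. -/
noncomputable def collision : ℝ := avg R (keyFun (keyMass R))

/-- The fraction of vertices whose path does not stop at a key. -/
noncomputable def absorbed : ℝ := avg R (Sum.elim (fun _ => 0) fun _ => 1)

/-- Indicator of the fates that are not a key outside `P`. -/
def offFresh (P : Finset (Fin m)) : Fate m → ℝ :=
  Sum.elim (fun r => if r ∈ P then 1 else 0) fun _ => 1

variable {R}

theorem avg_add (f g : Fate m → ℝ) : avg R (fun c => f c + g c) = avg R f + avg R g := by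
  simp [avg, Finset.sum_add_distrib, add_div]

theorem avg_sub (f g : Fate m → ℝ) : avg R (fun c => f c - g c) = avg R f - avg R g := by
  simp [avg, Finset.sum_sub_distrib, sub_div]

theorem avg_mul_left (a : ℝ) (f : Fate m → ℝ) : avg R (fun c => a * f c) = a * avg R f := by
  simp [avg, ← Finset.mul_sum, mul_div_assoc]

theorem avg_mul_right (a : ℝ) (f : Fate m → ℝ) : avg R (fun c => f c * a) = avg R f * a := by
  simp [avg, ← Finset.sum_mul, div_mul_eq_mul_div]

theorem avg_const (hn : 0 < n) (a : ℝ) : avg R (fun _ => a) = a := by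
  have : (n : ℝ) ≠ 0 := by positivity
  simp [avg, this]

theorem avg_mono {f g : Fate m → ℝ} (h : ∀ c, f c ≤ g c) : avg R f ≤ avg R g := by
  unfold avg
  gcongr
  exact h _

theorem avg_nonneg {f : Fate m → ℝ} (h : ∀ c, 0 ≤ f c) : 0 ≤ avg R f :=
  div_nonneg (Finset.sum_nonneg fun _ _ => h _) (Nat.cast_nonneg _)

theorem mass_nonneg (c : Fate m) : 0 ≤ mass R c :=
  avg_nonneg fun c' => by split_ifs <;> simp

theorem keyMass_nonneg (r : Fin m) : 0 ≤ keyMass R r := mass_nonneg _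

theorem keyFun_nonneg {φ : Fin m → ℝ} (h : ∀ r, 0 ≤ φ r) (c : Fate m) : 0 ≤ keyFun φ c := by
  cases c <;> simp [keyFun, h]

theorem avg_keyFun_add (φ ψ : Fin m → ℝ) :
    avg R (keyFun fun r => φ r + ψ r) = avg R (keyFun φ) + avg R (keyFun ψ) := by
  rw [← avg_add]
  congr 1
  funext c
  cases c <;> simp [keyFun]

theorem avg_keyFun_mul (a : ℝ) (φ : Fin m → ℝ) :
    avg R (keyFun fun r => a * φ r) = a * avg R (keyFun φ) := by
  rw [← avg_mul_left]
  congr 1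
  funext c
  cases c <;> simp [keyFun]

theorem collision_nonneg : 0 ≤ collision R := avg_nonneg (keyFun_nonneg keyMass_nonneg)

theorem absorbed_nonneg : 0 ≤ absorbed R := avg_nonneg fun c => by cases c <;> simp

theorem offFresh_nonneg (P : Finset (Fin m)) (c : Fate m) : 0 ≤ offFresh P c := by
  cases c with
  | inl r => simp only [offFresh, Sum.elim_inl]; split_ifs <;> simp
  | inr i => simp [offFresh]

theorem avg_keyFun_ite (T : Finset (Fin m)) :
    avg R (keyFun fun r => if r ∈ T then 1 else 0) = ∑ r ∈ T, keyMass R r := by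
  simp only [avg, keyMass, mass]
  rw [← Finset.sum_div, Finset.sum_comm]
  congr 1
  refine Finset.sum_congr rfl fun y _ => ?_
  cases R y <;> simp [keyFun]

theorem avg_offFresh (P : Finset (Fin m)) :
    avg R (offFresh P) = absorbed R + ∑ r ∈ P, keyMass R r := by
  rw [← avg_keyFun_ite, absorbed, ← avg_add]
  congr 1
  funext c
  cases c <;> simp [offFresh, keyFun]

theorem collision_eq_sum_sq : collision R = ∑ r, keyMass R r ^ 2 := by
  have : keyFun (keyMass R) = fun c => ∑ r, (if c = .inl r then 1 else 0) * keyMass R r := by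
    funext c
    cases c <;> simp [keyFun]
  simp only [collision, this, avg]
  rw [Finset.sum_comm, Finset.sum_div]
  refine Finset.sum_congr rfl fun r _ => ?_
  rw [← Finset.sum_mul, sq, mul_div_right_comm]
  rfl

end Average

section Walk

variable {n m κ : ℕ} {R : Fin n → Fate m} {E : (Layer n m → ℝ) →ₗ[ℝ] ℝ}

@[simp] theorem walk_inr (g : Layer n m) (j : ℕ) (S : Finset (Fin m)) (i : Fin 3) :
    walk R g j S (.inr i) = .inr i := by
  cases j <;> rfl

@[simp] theorem walk_zero (g : Layer n m) (S : Finset (Fin m)) (r : Fin m) :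
    walk R g 0 S (.inl r) = .inr 2 := rfl

theorem walk_mem (g : Layer n m) (j : ℕ) {S : Finset (Fin m)} {r : Fin m} (h : r ∈ S) :
    walk R g j S (.inl r) = .inr 2 := by
  cases j <;> simp [walk, h]

theorem IsKWise.mono (hE : IsKWise κ E) {F G : Layer n m → ℝ} (h : ∀ g, F g ≤ G g) :
    E F ≤ E G := by
  have := hE.nonneg (G - F) fun g => sub_nonneg.2 (h g)
  rw [map_sub] at this
  linarith

/-- Expansion of one step of a walk. -/
theorem map_walk_succ (E : (Layer n m → ℝ) →ₗ[ℝ] ℝ) (X : Layer n m → ℝ)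
    (Ψ : Fate m → Layer n m → ℝ) (j : ℕ) {S : Finset (Fin m)} {r : Fin m} (hr : r ∉ S) :
    E (fun g => X g * Ψ (walk R g (j + 1) S (.inl r)) g) =
      E (fun g => (X g * if g r = none then 1 else 0) * Ψ (.inl r) g) +
      ∑ y, E (fun g => (X g * if g r = some y then 1 else 0) *
        Ψ (walk R g j (insert r S) (R y)) g) := by
  rw [← map_sum, ← map_add]
  congr 1
  funext g
  simp only [walk, if_neg hr, Pi.add_apply, Finset.sum_apply]
  cases hg : g r <;> simp

theorem DependsOn.mul_ite {X : Layer n m → ℝ} {P : Finset (Fin m)}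
    (hX : DependsOn X (P : Set (Fin m))) (r : Fin m) (a : Option (Fin n)) :
    DependsOn (fun g => X g * if g r = a then 1 else 0) ((insert r P : Finset (Fin m)) : Set (Fin m))
    := by
  intro g g' h
  have h1 : X g = X g' := hX fun i hi => h i (by simp at hi ⊢; exact Or.inr hi)
  have h2 : g r = g' r := h r (by simp)
  simp only [h1, h2]

theorem mul_ite_nonneg {X : Layer n m → ℝ} (hX : ∀ g, 0 ≤ X g) (r : Fin m) (a : Option (Fin n))
    (g : Layer n m) : 0 ≤ X g * if g r = a then 1 else 0 := by
  have := hX g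
  split_ifs <;> simp [this]

theorem IsKWise.sum_fresh_le (hE : IsKWise κ E) {X : Layer n m → ℝ} {P : Finset (Fin m)}
    (hX : DependsOn X (P : Set (Fin m))) {r : Fin m} (hr : r ∉ P) (hP : P.card < κ)
    {b : Fate m → ℝ} {F : Fin n → Layer n m → ℝ}
    (h : ∀ y, E (F y) ≤ E (fun g => X g * if g r = some y then 1 else 0) * b (R y)) :
    ∑ y, E (F y) ≤ E X * (avg R b / 2) := by
  calc ∑ y, E (F y) ≤ ∑ y, E X / (2 * n) * b (R y) :=
        Finset.sum_le_sum fun y _ => by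
          rw [← hE.fresh_some P r X y hP hr hX]; exact h y
    _ = E X * (avg R b / 2) := by
        rw [← Finset.mul_sum, avg, div_mul_eq_mul_div, div_div, mul_div_assoc, mul_comm (2 : ℝ)]

theorem IsKWise.le_sum_fresh (hE : IsKWise κ E) {X : Layer n m → ℝ} {P : Finset (Fin m)}
    (hX : DependsOn X (P : Set (Fin m))) {r : Fin m} (hr : r ∉ P) (hP : P.card < κ)
    {b : Fate m → ℝ} {F : Fin n → Layer n m → ℝ}
    (h : ∀ y, E (fun g => X g * if g r = some y then 1 else 0) * b (R y) ≤ E (F y)) :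
    E X * (avg R b / 2) ≤ ∑ y, E (F y) := by
  calc E X * (avg R b / 2) = ∑ y, E X / (2 * n) * b (R y) := by
        rw [← Finset.mul_sum, avg, div_mul_eq_mul_div, div_div, mul_div_assoc, mul_comm (2 : ℝ)]
    _ ≤ ∑ y, E (F y) := Finset.sum_le_sum fun y _ => by
          rw [← hE.fresh_some P r X y hP hr hX]; exact h y

/-- Every key of `Q` is mapped by `g` to a vertex whose fate is a label in `Λ` or a key of `Q`. -/
def Traps (R : Fin n → Fate m) (Λ : Set (Fin 3)) (Q : Finset (Fin m)) (g : Layer n m) : Prop :=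
  ∀ r ∈ Q, ∃ y, g r = some y ∧ ((∃ i ∈ Λ, R y = .inr i) ∨ ∃ r' ∈ Q, R y = .inl r')

theorem Traps.walk_eq {Λ : Set (Fin 3)} {Q : Finset (Fin m)} {g : Layer n m} (h : Traps R Λ Q g)
    (j : ℕ) (S : Finset (Fin m)) {r : Fin m} (hr : r ∈ Q) :
    ∃ i, walk R g j S (.inl r) = .inr i ∧ (i ∈ Λ ∨ i = 2) := by
  induction j generalizing S r with
  | zero => exact ⟨2, by simp⟩
  | succ j ih =>
    by_cases hS : r ∈ S
    · exact ⟨2, walk_mem g _ hS, Or.inr rfl⟩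
    · obtain ⟨y, hy, ⟨i, hi, hR⟩ | ⟨r', hr', hR⟩⟩ := h r hr
      · exact ⟨i, by simp [walk, hS, hy, hR], Or.inl hi⟩
      · obtain ⟨i, hi⟩ := ih (insert r S) hr'
        exact ⟨i, by simpa [walk, hS, hy, hR] using hi⟩

/-- Upper bound for a walk that reaches a target, in an environment `Q` that leads elsewhere. -/
theorem IsKWise.reach_le (hn : 0 < n) (hE : IsKWise κ E) {N : ℕ} (hN : N ≤ κ) {Λ : Set (Fin 3)}
    {i : Fin 3} (hi : i ∉ Λ) (hi2 : i ≠ 2) {B : Layer n m → ℝ} {α : ℝ} (hα : 0 ≤ α)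
    {φ : Fin m → ℝ} (hφ : ∀ r, 0 ≤ φ r)
    (hB : ∀ (Q : Finset (Fin m)) (X : Layer n m → ℝ), (∀ g, 0 ≤ X g) → Q.card ≤ N →
      DependsOn X (Q : Set (Fin m)) → (∀ g, X g ≠ 0 → Traps R (insert i Λ) Q g) →
      E (fun g => X g * B g) ≤ E X * (α + ∑ r ∈ Q, φ r))
    (Q : Finset (Fin m)) (j : ℕ) (S : Finset (Fin m)) (c : Fate m) (X : Layer n m → ℝ)
    (hX0 : ∀ g, 0 ≤ X g) (hcard : (Q ∪ S).card + j ≤ N)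
    (hX : DependsOn X ((Q ∪ S : Finset (Fin m)) : Set (Fin m)))
    (hQ : ∀ g, X g ≠ 0 → Traps R Λ Q g)
    (hS : ∀ g, X g ≠ 0 → ∀ r ∈ S, ∃ y, g r = some y ∧ (R y = c ∨ ∃ r' ∈ S, R y = .inl r')) :
    E (fun g => X g * ((if walk R g j S c = .inr i then 1 else 0) * B g)) ≤
      E X * (((if c = .inr i then 1 else 0) + mass R (.inr i)) * (α + ∑ r ∈ Q ∪ S, φ r) +
        mass R (.inr i) * (keyFun φ c + avg R (keyFun φ))) := by
  have hq : 0 ≤ mass R (.inr i) := mass_nonneg _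
  have hav : 0 ≤ avg R (keyFun φ) := avg_nonneg (keyFun_nonneg hφ)
  have hrhs : ∀ (P : Finset (Fin m)) (c : Fate m), 0 ≤ mass R (.inr i) * (α + ∑ r ∈ P, φ r) +
        mass R (.inr i) * (keyFun φ c + avg R (keyFun φ)) := fun P c => by
    have := keyFun_nonneg hφ c
    have : 0 ≤ ∑ r ∈ P, φ r := Finset.sum_nonneg fun r _ => hφ r
    positivity
  have hzero : ∀ {F : Layer n m → ℝ} {a : ℝ} (X : Layer n m → ℝ), (∀ g, 0 ≤ X g) → 0 ≤ a →
      (∀ g, F g = 0) → E F ≤ E X * a := by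
    intro F a X hX0 ha hF
    have : F = 0 := funext hF
    rw [this, map_zero]
    exact mul_nonneg (hE.nonneg X hX0) ha
  induction j generalizing S c X with
  | zero =>
    rcases c with r | i'
    · refine hzero X hX0 ?_ fun g => ?_
      · simpa using hrhs (Q ∪ S) (.inl r)
      · simp [Ne.symm hi2]
    · by_cases h : i' = i
      · subst h
        simp only [walk_inr, if_true, one_mul]
        refine (hB (Q ∪ S) X hX0 (by omega) hX fun g hg r hr => ?_).trans ?_
        · rcases Finset.mem_union.1 hr with hr | hr
          · obtain ⟨y, hy, ⟨i, hi, hR⟩ | ⟨r', hr', hR⟩⟩ := hQ g hg r hr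
            · exact ⟨y, hy, Or.inl ⟨i, Or.inr hi, hR⟩⟩
            · exact ⟨y, hy, Or.inr ⟨r', Finset.mem_union_left _ hr', hR⟩⟩
          · obtain ⟨y, hy, hR | ⟨r', hr', hR⟩⟩ := hS g hg r hr
            · exact ⟨y, hy, Or.inl ⟨_, Or.inl rfl, hR⟩⟩
            · exact ⟨y, hy, Or.inr ⟨r', Finset.mem_union_right _ hr', hR⟩⟩
        · have := hrhs (Q ∪ S) (.inr i')
          exact mul_le_mul_of_nonneg_left (by linarith) (hE.nonneg X hX0)
      · refine hzero X hX0 ?_ fun g => ?_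
        · simpa [h] using hrhs (Q ∪ S) (.inr i')
        · simp [h]
  | succ j ih =>
    rcases c with r | i'
    · simp only [reduceCtorEq, if_false, zero_add]
      by_cases hrS : r ∈ S
      · exact hzero X hX0 (hrhs _ _) fun g => by simp [walk_mem g _ hrS, Ne.symm hi2]
      by_cases hrQ : r ∈ Q
      · refine hzero X hX0 (hrhs _ _) fun g => ?_
        by_cases hg : X g = 0
        · simp [hg]
        · obtain ⟨i', hw, hi'⟩ := (hQ g hg).walk_eq (j + 1) S hrQ
          have : i' ≠ i := by rintro rfl; exact hi'.elim hi hi2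
          simp [hw, this]
      have hr : r ∉ Q ∪ S := by simp [hrS, hrQ]
      have hins : Q ∪ insert r S = insert r (Q ∪ S) := Finset.union_insert _ _ _
      rw [map_walk_succ E X (fun c g => (if c = .inr i then 1 else 0) * B g) j hrS]
      have h0 : E (fun g => (X g * if g r = none then 1 else 0) *
          ((if (Sum.inl r : Fate m) = .inr i then 1 else 0) * B g)) = 0 := by
        simp only [reduceCtorEq, if_false, zero_mul, mul_zero]; exact map_zero E
      rw [h0, zero_add]
      refine (hE.sum_fresh_le (R := R) hX hr (by omega)
        (b := (fun c => ((if c = .inr i then 1 else 0) + mass R (.inr i)) *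
        (α + ∑ r ∈ Q ∪ insert r S, φ r) + mass R (.inr i) * (keyFun φ c + avg R (keyFun φ)))) fun y =>
        ih (insert r S) (R y) _ (mul_ite_nonneg hX0 r (some y)) ?_ ?_ ?_ ?_).trans (le_of_eq ?_)
      · rw [hins, Finset.card_insert_of_notMem hr]; omega
      · rw [hins]; exact DependsOn.mul_ite hX r _
      · exact fun g hg => hQ g (left_ne_zero_of_mul hg)
      · intro g hg r' hr'
        have hgr : g r = some y := by by_contra h; simp [h] at hg
        rcases Finset.mem_insert.1 hr' with rfl | hr'
        · exact ⟨y, hgr, Or.inl rfl⟩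
        · obtain ⟨z, hz, hR | ⟨r'', hr'', hR⟩⟩ := hS g (left_ne_zero_of_mul hg) r' hr'
          · exact ⟨z, hz, Or.inr ⟨r, by simp, hR⟩⟩
          · exact ⟨z, hz, Or.inr ⟨r'', by simp [hr''], hR⟩⟩
      · rw [hins, Finset.sum_insert hr]
        congr 1
        rw [avg_add, avg_mul_right, avg_add, avg_const hn, avg_mul_left, avg_add, avg_const hn]
        simp only [keyFun, Sum.elim_inl, mass]
        ring
    · by_cases h : i' = i
      · subst h
        have := ih S (.inr i') X hX0 (by omega) hX hQ hS
        simpa only [walk_inr] using this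
      · refine hzero X hX0 ?_ fun g => ?_
        · simpa [h] using hrhs (Q ∪ S) (.inr i')
        · simp [h]

/-- Upper bound for a walk that does not stop at a key. -/
theorem IsKWise.absorb_le (hn : 0 < n) (hE : IsKWise κ E) (j : ℕ) (S P : Finset (Fin m))
    (hSP : S ⊆ P) (c : Fate m) (X : Layer n m → ℝ) (hX0 : ∀ g, 0 ≤ X g)
    (hcard : P.card + j ≤ κ) (hX : DependsOn X (P : Set (Fin m))) :
    E (fun g => X g * Sum.elim (fun _ => 0) (fun _ => 1) (walk R g j S c)) ≤
      E X * (offFresh P c + (1 / 2) ^ j + absorbed R + ∑ r ∈ P, keyMass R r +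
        keyFun (keyMass R) c + collision R) := by
  have hd : 0 ≤ absorbed R := absorbed_nonneg
  have hW : 0 ≤ collision R := collision_nonneg
  have htriv : ∀ (P S : Finset (Fin m)) (c : Fate m) (X : Layer n m → ℝ) (j : ℕ),
      (∀ g, 0 ≤ X g) → 1 ≤ offFresh P c + (1 / 2) ^ j →
      E (fun g => X g * Sum.elim (fun _ => 0) (fun _ => 1) (walk R g j S c)) ≤
      E X * (offFresh P c + (1 / 2) ^ j + absorbed R + ∑ r ∈ P, keyMass R r +
        keyFun (keyMass R) c + collision R) := by
    intro P S c X j hX0 h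
    have h1 : 0 ≤ ∑ r ∈ P, keyMass R r := Finset.sum_nonneg fun r _ => keyMass_nonneg r
    have h2 := keyFun_nonneg (keyMass_nonneg (R := R)) c
    calc _ ≤ E X := hE.mono fun g => by
          have := hX0 g
          cases walk R g j S c <;> simp [this]
      _ ≤ _ := le_mul_of_one_le_right (hE.nonneg X hX0) (by linarith)
  induction j generalizing S P c X with
  | zero =>
    refine htriv P S c X 0 hX0 ?_
    have := offFresh_nonneg P c
    norm_num
    exact this
  | succ j ih =>
    have hpow : (0 : ℝ) ≤ (1 / 2) ^ (j + 1) := by positivity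
    rcases c with r | i
    · by_cases hr : r ∈ P
      · exact htriv P S _ X _ hX0 (by simp only [offFresh, Sum.elim_inl, if_pos hr]; linarith)
      have hrS : r ∉ S := fun h => hr (hSP h)
      rw [map_walk_succ E X (fun c _ => Sum.elim (fun _ => 0) (fun _ => 1) c) j hrS]
      have h0 : E (fun g => (X g * if g r = none then 1 else 0) *
          Sum.elim (fun _ => 0) (fun _ => 1) (Sum.inl r : Fate m)) = 0 := by
        simp only [Sum.elim_inl, mul_zero]; exact map_zero E
      rw [h0, zero_add]
      refine (hE.sum_fresh_le (R := R) hX hr (by omega)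
        (b := (fun c => offFresh (insert r P) c + (1 / 2) ^ j + absorbed R +
        ∑ r ∈ insert r P, keyMass R r + keyFun (keyMass R) c + collision R)) fun y =>
        ih (insert r S) (insert r P) (Finset.insert_subset_insert _ hSP) (R y) _
          (mul_ite_nonneg hX0 r (some y)) ?_ (DependsOn.mul_ite hX r _)).trans (le_of_eq ?_)
      · rw [Finset.card_insert_of_notMem hr]; omega
      · rw [Finset.sum_insert hr]
        congr 1
        simp only [avg_add, avg_const hn, avg_offFresh, Finset.sum_insert hr]
        rw [← collision]
        simp only [offFresh, keyFun, Sum.elim_inl, if_neg hr, pow_succ]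
        ring
    · exact htriv P S _ X _ hX0 (by simp only [offFresh, Sum.elim_inr]; linarith)

/-- Upper bound for a walk that stops at a key `r` of a set `T` of known keys. -/
theorem IsKWise.hit_le (hE : IsKWise κ E) {Λ : Set (Fin 3)} {Q T : Finset (Fin m)}
    {r : Fin m} (hrT : r ∈ T) (j : ℕ) (S : Finset (Fin m)) (c : Fate m) (X : Layer n m → ℝ)
    (hX0 : ∀ g, 0 ≤ X g) (hcard : (Q ∪ T ∪ S).card + j ≤ κ)
    (hX : DependsOn X ((Q ∪ T ∪ S : Finset (Fin m)) : Set (Fin m)))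
    (hQ : ∀ g, X g ≠ 0 → Traps R Λ Q g) :
    E (fun g => X g * if walk R g j S c = .inl r then 1 else 0) ≤
      E X * (keyFun (fun r => if r ∈ T then 1 else 0) c + ∑ r ∈ T, keyMass R r) := by
  have hT : 0 ≤ ∑ r ∈ T, keyMass R r := Finset.sum_nonneg fun r _ => keyMass_nonneg r
  have hk : ∀ c : Fate m, 0 ≤ keyFun (fun r => if r ∈ T then (1 : ℝ) else 0) c :=
    keyFun_nonneg fun r => by split_ifs <;> simp
  have hzero : ∀ {F : Layer n m → ℝ} {a : ℝ} (X : Layer n m → ℝ), (∀ g, 0 ≤ X g) → 0 ≤ a →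
      (∀ g, F g = 0) → E F ≤ E X * a := by
    intro F a X hX0 ha hF
    have : F = 0 := funext hF
    rw [this, map_zero]
    exact mul_nonneg (hE.nonneg X hX0) ha
  induction j generalizing S c X with
  | zero => exact hzero X hX0 (add_nonneg (hk c) hT) fun g => by cases c <;> simp
  | succ j ih =>
    rcases c with r' | i
    · by_cases hrS : r' ∈ S
      · exact hzero X hX0 (add_nonneg (hk _) hT) fun g => by simp [walk_mem g _ hrS]
      by_cases hrQ : r' ∈ Q
      · refine hzero X hX0 (add_nonneg (hk _) hT) fun g => ?_
        by_cases hg : X g = 0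
        · simp [hg]
        · obtain ⟨i', hw, -⟩ := (hQ g hg).walk_eq (j + 1) S hrQ
          simp [hw]
      by_cases hrT' : r' ∈ T
      · calc _ ≤ E X := hE.mono fun g => by
              have := hX0 g
              split_ifs <;> simp [this]
          _ ≤ _ := le_mul_of_one_le_right (hE.nonneg X hX0) (by
              simp only [keyFun, Sum.elim_inl, if_pos hrT']; linarith)
      have hr : r' ∉ Q ∪ T ∪ S := by simp [hrS, hrQ, hrT']
      have hne : r' ≠ r := fun h => hrT' (h ▸ hrT)
      have hins : Q ∪ T ∪ insert r' S = insert r' (Q ∪ T ∪ S) := Finset.union_insert _ _ _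
      rw [map_walk_succ E X (fun c _ => if c = .inl r then 1 else 0) j hrS]
      have h0 : E (fun g => (X g * if g r' = none then 1 else 0) *
          if (Sum.inl r' : Fate m) = .inl r then 1 else 0) = 0 := by
        simp only [Sum.inl.injEq, if_neg hne, mul_zero]; exact map_zero E
      rw [h0, zero_add]
      refine (hE.sum_fresh_le (R := R) hX hr (by omega)
        (b := (fun c => keyFun (fun r => if r ∈ T then 1 else 0) c +
        ∑ r ∈ T, keyMass R r)) fun y =>
        ih (insert r' S) (R y) _ (mul_ite_nonneg hX0 r' (some y)) ?_ ?_ ?_).trans ?_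
      · rw [hins, Finset.card_insert_of_notMem hr]; omega
      · rw [hins]; exact DependsOn.mul_ite hX r' _
      · exact fun g hg => hQ g (left_ne_zero_of_mul hg)
      · refine mul_le_mul_of_nonneg_left ?_ (hE.nonneg X hX0)
        rcases Nat.eq_zero_or_pos n with rfl | hn
        · simpa [avg] using add_nonneg (hk _) hT
        rw [avg_add, avg_keyFun_ite, avg_const hn]
        simp [keyFun, hrT']
    · exact hzero X hX0 (add_nonneg (hk _) hT) fun g => by simp

/-- Upper bound for the meeting of a walk from a random vertex with a walk of given fate. -/
theorem IsKWise.meet_le (hn : 0 < n) (hE : IsKWise κ E) {Λ : Set (Fin 3)} {Q : Finset (Fin m)}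
    (l j : ℕ) (S : Finset (Fin m)) (c : Fate m) (X : Layer n m → ℝ)
    (hX0 : ∀ g, 0 ≤ X g) (hcard : (Q ∪ S).card + j + l ≤ κ)
    (hX : DependsOn X ((Q ∪ S : Finset (Fin m)) : Set (Fin m)))
    (hQ : ∀ g, X g ≠ 0 → Traps R Λ Q g) :
    E (fun g => X g * keyFun (fun r => avg R fun c' =>
        if walk R g l ∅ c' = .inl r then 1 else 0) (walk R g j S c)) ≤
      E X * (2 * ∑ r ∈ S, keyMass R r + 2 * keyFun (keyMass R) c + 2 * collision R) := by
  have hW : 0 ≤ collision R := collision_nonneg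
  have hk := keyFun_nonneg (keyMass_nonneg (R := R))
  have hs : ∀ S : Finset (Fin m), 0 ≤ ∑ r ∈ S, keyMass R r :=
    fun S => Finset.sum_nonneg fun r _ => keyMass_nonneg r
  have hpos : ∀ (S : Finset (Fin m)) (c : Fate m),
      0 ≤ 2 * ∑ r ∈ S, keyMass R r + 2 * keyFun (keyMass R) c + 2 * collision R := fun S c => by
    linarith [hk c, hs S]
  have hzero : ∀ {F : Layer n m → ℝ} {a : ℝ} (X : Layer n m → ℝ), (∀ g, 0 ≤ X g) → 0 ≤ a →
      (∀ g, F g = 0) → E F ≤ E X * a := by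
    intro F a X hX0 ha hF
    have : F = 0 := funext hF
    rw [this, map_zero]
    exact mul_nonneg (hE.nonneg X hX0) ha
  induction j generalizing S c X with
  | zero => exact hzero X hX0 (hpos S c) fun g => by cases c <;> simp [keyFun]
  | succ j ih =>
    rcases c with r | i
    · by_cases hrS : r ∈ S
      · exact hzero X hX0 (hpos _ _) fun g => by simp [walk_mem g _ hrS, keyFun]
      by_cases hrQ : r ∈ Q
      · refine hzero X hX0 (hpos _ _) fun g => ?_
        by_cases hg : X g = 0
        · simp [hg]
        · obtain ⟨i', hw, -⟩ := (hQ g hg).walk_eq (j + 1) S hrQ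
          simp [hw, keyFun]
      have hr : r ∉ Q ∪ S := by simp [hrS, hrQ]
      have hins : Q ∪ insert r S = insert r (Q ∪ S) := Finset.union_insert _ _ _
      rw [map_walk_succ E X (fun c g => keyFun (fun r => avg R fun c' =>
        if walk R g l ∅ c' = .inl r then 1 else 0) c) j hrS]
      have h0 : E (fun g => (X g * if g r = none then 1 else 0) * keyFun (fun r => avg R fun c' =>
          if walk R g l ∅ c' = .inl r then 1 else 0) (.inl r)) ≤
          E X * (∑ r ∈ S, keyMass R r + keyMass R r) := by
        set X' : Layer n m → ℝ := fun g => X g * if g r = none then 1 else 0 with hX'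
        have hX'E : E X' = E X / 2 := hE.fresh_none (Q ∪ S) r X (by omega) hr hX
        have key : ∀ y, E (fun g => X' g * if walk R g l ∅ (R y) = .inl r then 1 else 0) ≤
            E X' * (keyFun (fun r' => if r' ∈ insert r S then 1 else 0) (R y) +
              ∑ r' ∈ insert r S, keyMass R r') := fun y => by
          refine hE.hit_le (Λ := Λ) (Q := Q) (T := insert r S) (by simp) l ∅ (R y) X'
            (mul_ite_nonneg hX0 r _) ?_ ?_ ?_
          · rw [Finset.union_empty, hins, Finset.card_insert_of_notMem hr]; omega
          · rw [Finset.union_empty, hins]; exact DependsOn.mul_ite hX r _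
          · exact fun g hg => hQ g (left_ne_zero_of_mul hg)
        calc _ = (∑ y, E (fun g => X' g * if walk R g l ∅ (R y) = .inl r then 1 else 0)) / n := by
              rw [← map_sum, div_eq_inv_mul, ← smul_eq_mul, ← map_smul]
              congr 1
              funext g
              simp only [keyFun, Sum.elim_inl, avg, Pi.smul_apply, Finset.sum_apply, smul_eq_mul,
                ← Finset.mul_sum, hX']
              ring
          _ ≤ (∑ y, E X' * (keyFun (fun r' => if r' ∈ insert r S then 1 else 0) (R y) +
              ∑ r' ∈ insert r S, keyMass R r')) / n := by
              gcongr with y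
              exact key y
          _ = avg R (fun c => E X' * (keyFun (fun r' => if r' ∈ insert r S then 1 else 0) c +
              ∑ r' ∈ insert r S, keyMass R r')) := rfl
          _ = _ := by
              rw [avg_mul_left, avg_add, avg_keyFun_ite, avg_const hn, Finset.sum_insert hrS, hX'E]
              ring
      have h1 : ∑ y, E (fun g => (X g * if g r = some y then 1 else 0) *
          keyFun (fun r => avg R fun c' => if walk R g l ∅ c' = .inl r then 1 else 0)
            (walk R g j (insert r S) (R y))) ≤
          E X * (∑ r ∈ S, keyMass R r + keyMass R r + 2 * collision R) := by
        refine (hE.sum_fresh_le (R := R) hX hr (by omega)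
        (b := (fun c => 2 * ∑ r ∈ insert r S, keyMass R r +
          2 * keyFun (keyMass R) c + 2 * collision R)) fun y =>
          ih (insert r S) (R y) _ (mul_ite_nonneg hX0 r (some y)) ?_ ?_ ?_).trans (le_of_eq ?_)
        · rw [hins, Finset.card_insert_of_notMem hr]; omega
        · rw [hins]; exact DependsOn.mul_ite hX r _
        · exact fun g hg => hQ g (left_ne_zero_of_mul hg)
        · congr 1
          simp only [avg_add, avg_const hn, avg_mul_left, Finset.sum_insert hrS]
          rw [← collision]
          ring
      refine (add_le_add h0 h1).trans (le_of_eq ?_)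
      simp only [keyFun, Sum.elim_inl]
      ring
    · exact hzero X hX0 (hpos _ _) fun g => by simp [keyFun]

/-- Lower bound for a walk that reaches a target. -/
theorem IsKWise.le_reach (hn : 0 < n) (hE : IsKWise κ E) {N : ℕ} (hN : N ≤ κ)
    (i : Fin 3) {B : Layer n m → ℝ} (hB0 : ∀ g, 0 ≤ B g) {A e : ℝ} (hA : 0 ≤ A) (he : 0 ≤ e)
    {φ : Fin m → ℝ} (hφ : ∀ r, 0 ≤ φ r)
    (hB : ∀ (Q : Finset (Fin m)) (X : Layer n m → ℝ), (∀ g, 0 ≤ X g) → Q.card ≤ N →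
      DependsOn X (Q : Set (Fin m)) → E X * (A * (1 - e - ∑ r ∈ Q, φ r)) ≤ E (fun g => X g * B g))
    (j : ℕ) (S P : Finset (Fin m)) (hSP : S ⊆ P) (c : Fate m) (X : Layer n m → ℝ)
    (hX0 : ∀ g, 0 ≤ X g) (hcard : P.card + j ≤ N) (hX : DependsOn X (P : Set (Fin m))) :
    E X * (A * (((if c = .inr i then 1 else 0) + (1 - (1 / 2) ^ j) * mass R (.inr i)) -
        ((if c = .inr i then 1 else 0) + mass R (.inr i)) * (e + ∑ r ∈ P, φ r) -
        mass R (.inr i) * (keyFun φ c + avg R (keyFun φ)) -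
        mass R (.inr i) * (offFresh P c + absorbed R + ∑ r ∈ P, keyMass R r +
          keyFun (keyMass R) c + collision R))) ≤
      E (fun g => X g * ((if walk R g j S c = .inr i then 1 else 0) * B g)) := by
  have hq : 0 ≤ mass R (.inr i) := mass_nonneg _
  have hd : 0 ≤ absorbed R := absorbed_nonneg
  have hW : 0 ≤ collision R := collision_nonneg
  have hav : 0 ≤ avg R (keyFun φ) := avg_nonneg (keyFun_nonneg hφ)
  have hk := keyFun_nonneg (keyMass_nonneg (R := R))
  have hneg : ∀ (P S : Finset (Fin m)) (c : Fate m) (X : Layer n m → ℝ) (j : ℕ),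
      (∀ g, 0 ≤ X g) → c ≠ .inr i → 1 ≤ offFresh P c + (1 / 2) ^ j →
      E X * (A * (((if c = .inr i then 1 else 0) + (1 - (1 / 2) ^ j) * mass R (.inr i)) -
        ((if c = .inr i then 1 else 0) + mass R (.inr i)) * (e + ∑ r ∈ P, φ r) -
        mass R (.inr i) * (keyFun φ c + avg R (keyFun φ)) -
        mass R (.inr i) * (offFresh P c + absorbed R + ∑ r ∈ P, keyMass R r +
          keyFun (keyMass R) c + collision R))) ≤
      E (fun g => X g * ((if walk R g j S c = .inr i then 1 else 0) * B g)) := by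
    intro P S c X j hX0 hc h
    have h1 : 0 ≤ ∑ r ∈ P, keyMass R r := Finset.sum_nonneg fun r _ => keyMass_nonneg r
    have h2 : 0 ≤ ∑ r ∈ P, φ r := Finset.sum_nonneg fun r _ => hφ r
    have h3 := hk c
    have h4 := keyFun_nonneg hφ c
    refine le_trans (mul_nonpos_of_nonneg_of_nonpos (hE.nonneg X hX0)
      (mul_nonpos_of_nonneg_of_nonpos hA ?_)) (hE.nonneg _ fun g => ?_)
    · rw [if_neg hc]
      have : mass R (.inr i) * ((1 - (1 / 2) ^ j) - (e + ∑ r ∈ P, φ r) -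
        (keyFun φ c + avg R (keyFun φ)) - (offFresh P c + absorbed R + ∑ r ∈ P, keyMass R r +
          keyFun (keyMass R) c + collision R)) ≤ 0 :=
        mul_nonpos_of_nonneg_of_nonpos hq (by linarith)
      linarith
    · have := hX0 g
      have := hB0 g
      split_ifs <;> positivity
  have htarget : ∀ (P S : Finset (Fin m)) (X : Layer n m → ℝ) (j : ℕ),
      (∀ g, 0 ≤ X g) → P.card ≤ N → DependsOn X (P : Set (Fin m)) →
      E X * (A * (((if Sum.inr i = (Sum.inr i : Fate m) then 1 else 0) +
          (1 - (1 / 2) ^ j) * mass R (.inr i)) -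
        ((if Sum.inr i = (Sum.inr i : Fate m) then 1 else 0) + mass R (.inr i)) *
          (e + ∑ r ∈ P, φ r) -
        mass R (.inr i) * (keyFun φ (.inr i) + avg R (keyFun φ)) -
        mass R (.inr i) * (offFresh P (.inr i) + absorbed R + ∑ r ∈ P, keyMass R r +
          keyFun (keyMass R) (.inr i) + collision R))) ≤
      E (fun g => X g * ((if walk R g j S (.inr i) = .inr i then 1 else 0) * B g)) := by
    intro P S X j hX0 hP hX
    have h1 : 0 ≤ ∑ r ∈ P, keyMass R r := Finset.sum_nonneg fun r _ => keyMass_nonneg r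
    have h2 : 0 ≤ ∑ r ∈ P, φ r := Finset.sum_nonneg fun r _ => hφ r
    have hpow : (0 : ℝ) ≤ (1 / 2) ^ j := by positivity
    simp only [walk_inr, if_true, one_mul]
    refine le_trans ?_ (hB P X hX0 hP hX)
    refine mul_le_mul_of_nonneg_left (mul_le_mul_of_nonneg_left ?_ hA) (hE.nonneg X hX0)
    simp only [keyFun, offFresh, Sum.elim_inr]
    have : mass R (.inr i) * ((1 - (1 / 2) ^ j) - (e + ∑ r ∈ P, φ r) -
        (0 + avg R (keyFun φ)) - (1 + absorbed R + ∑ r ∈ P, keyMass R r +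
          0 + collision R)) ≤ 0 :=
        mul_nonpos_of_nonneg_of_nonpos hq (by linarith)
    simp only [keyFun] at this
    linarith
  induction j generalizing S P c X with
  | zero =>
    by_cases hc : c = .inr i
    · subst hc
      exact htarget P S X 0 hX0 (by omega) hX
    · refine hneg P S c X 0 hX0 hc ?_
      have := offFresh_nonneg P c
      simpa using this
  | succ j ih =>
    have hpow : (0 : ℝ) ≤ (1 / 2) ^ (j + 1) := by positivity
    rcases c with r | i'
    · by_cases hr : r ∈ P
      · exact hneg P S _ X _ hX0 (by simp)
          (by simp only [offFresh, Sum.elim_inl, if_pos hr]; linarith)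
      have hrS : r ∉ S := fun h => hr (hSP h)
      rw [map_walk_succ E X (fun c g => (if c = .inr i then 1 else 0) * B g) j hrS]
      have h0 : E (fun g => (X g * if g r = none then 1 else 0) *
          ((if (Sum.inl r : Fate m) = .inr i then 1 else 0) * B g)) = 0 := by
        simp only [reduceCtorEq, if_false, zero_mul, mul_zero]; exact map_zero E
      rw [h0, zero_add]
      refine le_trans (le_of_eq ?_) (hE.le_sum_fresh (R := R) hX hr (by omega)
        (b := (fun c => A * (((if c = .inr i then 1 else 0) +
        (1 - (1 / 2) ^ j) * mass R (.inr i)) -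
        ((if c = .inr i then 1 else 0) + mass R (.inr i)) * (e + ∑ r ∈ insert r P, φ r) -
        mass R (.inr i) * (keyFun φ c + avg R (keyFun φ)) -
        mass R (.inr i) * (offFresh (insert r P) c + absorbed R + ∑ r ∈ insert r P, keyMass R r +
          keyFun (keyMass R) c + collision R)))) fun y =>
        ih (insert r S) (insert r P) (Finset.insert_subset_insert _ hSP) (R y) _
          (mul_ite_nonneg hX0 r (some y)) ?_ (DependsOn.mul_ite hX r _))
      · congr 1
        rw [avg_mul_left]
        simp only [avg_add, avg_sub, avg_const hn, avg_mul_left, avg_mul_right, avg_offFresh,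
          Finset.sum_insert hr]
        rw [← collision, ← mass]
        simp only [offFresh, keyFun, Sum.elim_inl, if_neg hr, pow_succ, reduceCtorEq, if_false]
        ring
      · rw [Finset.card_insert_of_notMem hr]; omega
    · by_cases hc : i' = i
      · subst hc
        exact htarget P S X _ hX0 (by omega) hX
      · exact hneg P S _ X _ hX0 (by simpa using hc)
          (by simp only [offFresh, Sum.elim_inr]; linarith)

end Walk

section OneLayer

variable {n m κ : ℕ} {R : Fin n → Fate m} {E : (Layer n m → ℝ) →ₗ[ℝ] ℝ}

/-- The fates after the layer `g` is added, with walks of at most `l` steps. -/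
def nextFate (l : ℕ) (R : Fin n → Fate m) (g : Layer n m) : Fin n → Fate m :=
  fun x => walk R g l ∅ (R x)

/-- The product of the fractions of vertices which reach the two targets. -/
noncomputable def pairMass (R : Fin n → Fate m) : ℝ := mass R (.inr 0) * mass R (.inr 1)

/-- Indicator of the fates which are keys. -/
def isKey : Fate m → ℝ := Sum.elim (fun _ => 1) fun _ => 0

theorem pairMass_nonneg : 0 ≤ pairMass R := mul_nonneg (mass_nonneg _) (mass_nonneg _)

theorem map_avg (E : (Layer n m → ℝ) →ₗ[ℝ] ℝ) (F : Fate m → Layer n m → ℝ) :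
    E (fun g => avg R fun c => F c g) = avg R fun c => E (F c) := by
  simp only [avg]
  rw [← map_sum, div_eq_inv_mul, ← smul_eq_mul, ← map_smul]
  congr 1
  funext g
  simp [div_eq_inv_mul]

theorem map_mul_avg (E : (Layer n m → ℝ) →ₗ[ℝ] ℝ) (X : Layer n m → ℝ)
    (F : Fate m → Layer n m → ℝ) :
    E (fun g => X g * avg R fun c => F c g) = avg R fun c => E fun g => X g * F c g := by
  rw [← map_avg]
  simp only [avg_mul_left]

theorem IsKWise.reach_avg_le (hn : 0 < n) (hE : IsKWise κ E) {l N : ℕ} (hN : N ≤ κ)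
    {Λ : Set (Fin 3)} {i : Fin 3} (hi : i ∉ Λ) (hi2 : i ≠ 2) {B : Layer n m → ℝ} {α : ℝ}
    (hα : 0 ≤ α) {φ : Fin m → ℝ} (hφ : ∀ r, 0 ≤ φ r)
    (hB : ∀ (Q : Finset (Fin m)) (X : Layer n m → ℝ), (∀ g, 0 ≤ X g) → Q.card ≤ N →
      DependsOn X (Q : Set (Fin m)) → (∀ g, X g ≠ 0 → Traps R (insert i Λ) Q g) →
      E (fun g => X g * B g) ≤ E X * (α + ∑ r ∈ Q, φ r))
    (Q : Finset (Fin m)) (X : Layer n m → ℝ)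
    (hX0 : ∀ g, 0 ≤ X g) (hcard : Q.card + l ≤ N)
    (hX : DependsOn X (Q : Set (Fin m))) (hQ : ∀ g, X g ≠ 0 → Traps R Λ Q g) :
    E (fun g => X g * (mass (nextFate l R g) (.inr i) * B g)) ≤
      E X * (2 * mass R (.inr i) * (α + avg R (keyFun φ)) +
        ∑ r ∈ Q, 2 * mass R (.inr i) * φ r) := by
  have h : ∀ g, mass (nextFate l R g) (.inr i) * B g =
      avg R fun c => (if walk R g l ∅ c = .inr i then 1 else 0) * B g := fun g => by
    rw [avg_mul_right]; rfl
  simp only [h]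
  rw [map_mul_avg E X fun c g => (if walk R g l ∅ c = .inr i then 1 else 0) * B g]
  refine (avg_mono fun c => hE.reach_le hn hN hi hi2 hα hφ hB Q l ∅ c X hX0 (by simpa using hcard)
    (by simpa using hX) hQ (by simp)).trans (le_of_eq ?_)
  rw [avg_mul_left, avg_add, avg_mul_right, avg_add, avg_const hn, avg_mul_left, avg_add,
    avg_const hn, Finset.union_empty, ← mass, ← Finset.mul_sum]
  ring

theorem IsKWise.le_reach_avg (hn : 0 < n) (hE : IsKWise κ E) {l N : ℕ} (hN : N ≤ κ)
    (i : Fin 3) {B : Layer n m → ℝ} (hB0 : ∀ g, 0 ≤ B g) {A e : ℝ} (hA : 0 ≤ A) (he : 0 ≤ e)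
    {φ : Fin m → ℝ} (hφ : ∀ r, 0 ≤ φ r)
    (hB : ∀ (Q : Finset (Fin m)) (X : Layer n m → ℝ), (∀ g, 0 ≤ X g) → Q.card ≤ N →
      DependsOn X (Q : Set (Fin m)) → E X * (A * (1 - e - ∑ r ∈ Q, φ r)) ≤ E (fun g => X g * B g))
    (Q : Finset (Fin m)) (X : Layer n m → ℝ) (hX0 : ∀ g, 0 ≤ X g) (hcard : Q.card + l ≤ N)
    (hX : DependsOn X (Q : Set (Fin m))) :
    E X * (2 * mass R (.inr i) * A * (1 - (e + avg R (keyFun φ) + absorbed R + collision R +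
        (1 / 2) ^ l) - ∑ r ∈ Q, (φ r + keyMass R r))) ≤
      E (fun g => X g * (mass (nextFate l R g) (.inr i) * B g)) := by
  have h : ∀ g, mass (nextFate l R g) (.inr i) * B g =
      avg R fun c => (if walk R g l ∅ c = .inr i then 1 else 0) * B g := fun g => by
    rw [avg_mul_right]; rfl
  simp only [h]
  rw [map_mul_avg E X fun c g => (if walk R g l ∅ c = .inr i then 1 else 0) * B g]
  refine le_trans ?_ (avg_mono fun c => hE.le_reach hn hN i hB0 hA he hφ hB l ∅ Q (by simp) c X hX0
    hcard hX)
  rw [avg_mul_left]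
  refine mul_le_mul_of_nonneg_left ?_ (hE.nonneg X hX0)
  simp only [avg_add, avg_sub, avg_const hn, avg_mul_left, avg_mul_right, avg_offFresh,
    Finset.sum_add_distrib]
  rw [← collision, ← mass]
  have : 0 ≤ A * mass R (.inr i) * (1 / 2) ^ l := by
    have := mass_nonneg (R := R) (.inr i)
    positivity
  nlinarith [this]

theorem IsKWise.pairMass_next_le (hn : 0 < n) (hE : IsKWise κ E) {l N : ℕ} (hN : N ≤ κ)
    (hl : 2 * l ≤ N) {B : Layer n m → ℝ} {α : ℝ} (hα : 0 ≤ α) {φ : Fin m → ℝ}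
    (hφ : ∀ r, 0 ≤ φ r)
    (hB : ∀ (Q : Finset (Fin m)) (X : Layer n m → ℝ), (∀ g, 0 ≤ X g) → Q.card ≤ N →
      DependsOn X (Q : Set (Fin m)) → (∀ g, X g ≠ 0 → Traps R {1, 0} Q g) →
      E (fun g => X g * B g) ≤ E X * (α + ∑ r ∈ Q, φ r)) :
    E (fun g => pairMass (nextFate l R g) * B g) ≤
      4 * pairMass R * (α + 2 * avg R (keyFun φ)) := by
  have hq := mass_nonneg (R := R) (.inr 1)
  have hav : 0 ≤ avg R (keyFun φ) := avg_nonneg (keyFun_nonneg hφ)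
  have h1 := fun Q X hX0 hQ hX hT => hE.reach_avg_le (l := l) hn hN (Λ := {0}) (i := 1) (by simp)
    (by decide) hα hφ hB Q X hX0 (N := N) hQ hX hT
  have h2 := hE.reach_avg_le (R := R) (l := l) (N := N - l) hn (by omega) (Λ := ∅) (i := 0)
    (by simp) (by decide) (B := fun g => mass (nextFate l R g) (.inr 1) * B g)
    (α := 2 * mass R (.inr 1) * (α + avg R (keyFun φ))) (by positivity)
    (φ := fun r => 2 * mass R (.inr 1) * φ r)
    (fun r => by have := hφ r; positivity)
    (fun Q X hX0 hQ hX hT => h1 Q X hX0 (by omega) hX (by simpa using hT)) ∅ (fun _ => 1)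
    (by simp) (by simp; omega) (fun _ _ _ => rfl) (by simp [Traps])
  simp only [hE.one, one_mul, Finset.sum_empty, add_zero, ← mul_assoc] at h2
  unfold pairMass
  refine h2.trans (le_of_eq ?_)
  rw [avg_keyFun_mul]
  ring

theorem IsKWise.map_pairMass_le (hn : 0 < n) (hE : IsKWise κ E) {l : ℕ} (hl : 4 * l ≤ κ) :
    E (fun g => pairMass (nextFate l R g)) ≤ 4 * pairMass R := by
  have := hE.pairMass_next_le (R := R) (l := l) (N := κ) hn le_rfl (by omega) (B := fun _ => 1)
    (α := 1) zero_le_one (φ := fun _ => 0) (fun _ => le_rfl) (fun Q X _ _ _ _ => by simp)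
  have h0 : avg R (keyFun fun _ => 0) = 0 := by
    simp only [avg]; simp [keyFun]
  simpa [h0] using this

theorem IsKWise.map_absorbed_le (hn : 0 < n) (hE : IsKWise κ E) {l : ℕ} (hl : 4 * l ≤ κ) :
    E (fun g => pairMass (nextFate l R g) * absorbed (nextFate l R g)) ≤
      8 * (pairMass R * absorbed R) + 24 * (pairMass R * collision R) +
        4 * (1 / 2) ^ l * pairMass R := by
  have hd : 0 ≤ absorbed R := absorbed_nonneg
  have hW : 0 ≤ collision R := collision_nonneg
  have := hE.pairMass_next_le (R := R) (l := l) (N := κ - l) hn (by omega) (by omega)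
    (B := fun g => absorbed (nextFate l R g))
    (α := 2 * absorbed R + (1 / 2) ^ l + 2 * collision R) (by positivity)
    (φ := fun r => 2 * keyMass R r) (fun r => by have := keyMass_nonneg (R := R) r; positivity)
    (fun Q X hX0 hQ hX _ => by
      have h : ∀ g, absorbed (nextFate l R g) =
        avg R fun c => Sum.elim (fun _ => 0) (fun _ => 1) (walk R g l ∅ c) := fun g => rfl
      simp only [h]
      rw [map_mul_avg E X fun c g => Sum.elim (fun _ => 0) (fun _ => 1) (walk R g l ∅ c)]
      refine (avg_mono fun c => hE.absorb_le hn l ∅ Q (by simp) c X hX0 (by omega) hX).trans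
        (le_of_eq ?_)
      rw [avg_mul_left]
      simp only [avg_add, avg_const hn, avg_offFresh]
      rw [← collision, ← Finset.mul_sum]
      ring)
  refine this.trans (le_of_eq ?_)
  rw [avg_keyFun_mul, ← collision]
  ring

theorem IsKWise.map_meet_le (hn : 0 < n) (hE : IsKWise κ E) {l : ℕ} (hl : 4 * l ≤ κ)
    (ρ : Fate m) :
    E (fun g => pairMass (nextFate l R g) * keyFun (keyMass (nextFate l R g)) (walk R g l ∅ ρ)) ≤
      8 * (pairMass R * keyFun (keyMass R) ρ) + 8 * (pairMass R * collision R) := by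
  have hW : 0 ≤ collision R := collision_nonneg
  have hk := keyFun_nonneg (keyMass_nonneg (R := R)) ρ
  have := hE.pairMass_next_le (R := R) (l := l) (N := κ - 2 * l) hn (by omega) (by omega)
    (B := fun g => keyFun (keyMass (nextFate l R g)) (walk R g l ∅ ρ))
    (α := 2 * keyFun (keyMass R) ρ + 2 * collision R) (by positivity)
    (φ := fun r => 0) (fun _ => le_rfl)
    (fun Q X hX0 hQ hX hT => by
      have := hE.meet_le (S := ∅) hn l l ρ X hX0 (by rw [Finset.union_empty]; omega)
        (by simpa using hX) hT
      simp only [Finset.sum_empty, mul_zero, zero_add] at this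
      rw [Finset.sum_const_zero, add_zero]
      exact this)
  refine this.trans (le_of_eq ?_)
  have h0 : avg R (keyFun fun _ => 0) = 0 := by
    simp only [avg]; simp [keyFun]
  rw [h0]
  ring

theorem IsKWise.map_collision_le (hn : 0 < n) (hE : IsKWise κ E) {l : ℕ} (hl : 4 * l ≤ κ) :
    E (fun g => pairMass (nextFate l R g) * collision (nextFate l R g)) ≤
      16 * (pairMass R * collision R) := by
  have h : ∀ g, collision (nextFate l R g) =
      avg R fun c => keyFun (keyMass (nextFate l R g)) (walk R g l ∅ c) := fun g => rfl
  simp only [h]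
  rw [map_mul_avg E _ fun c g => keyFun (keyMass (nextFate l R g)) (walk R g l ∅ c)]
  refine (avg_mono fun c => hE.map_meet_le hn hl c).trans (le_of_eq ?_)
  simp only [avg_add, avg_const hn, avg_mul_left]
  rw [← collision]
  ring

theorem IsKWise.le_map_isKey (hn : 0 < n) (hE : IsKWise κ E) {l : ℕ} (hl : 4 * l ≤ κ)
    (ρ : Fate m) :
    4 * (pairMass R * isKey ρ) - 4 * (3 * (1 / 2) ^ l * pairMass R + 3 * (pairMass R * absorbed R) +
        3 * (pairMass R * keyFun (keyMass R) ρ) + 6 * (pairMass R * collision R)) ≤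
      E (fun g => pairMass (nextFate l R g) * isKey (walk R g l ∅ ρ)) := by
  have hd : 0 ≤ absorbed R := absorbed_nonneg
  have hW : 0 ≤ collision R := collision_nonneg
  have hp := mass_nonneg (R := R) (.inr 0)
  have hq := mass_nonneg (R := R) (.inr 1)
  have hpq := pairMass_nonneg (R := R)
  have hkey0 : ∀ c : Fate m, 0 ≤ isKey c := fun c => by cases c <;> simp [isKey]
  rcases ρ with r | i
  swap
  · refine le_trans ?_ (hE.nonneg _ fun g => mul_nonneg pairMass_nonneg (hkey0 _))
    simp only [isKey, keyFun, Sum.elim_inr]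
    have : 0 ≤ (1 / 2 : ℝ) ^ l * pairMass R := by positivity
    nlinarith [mul_nonneg hpq hd, mul_nonneg hpq hW]
  have hw := keyMass_nonneg (R := R) r
  have hφ0 : ∀ r', 0 ≤ keyMass R r' + if r' = r then (1 : ℝ) else 0 := fun r' => by
    have := keyMass_nonneg (R := R) r'
    split_ifs <;> positivity
  have hφa : avg R (keyFun fun r' => keyMass R r' + if r' = r then (1 : ℝ) else 0) =
      collision R + keyMass R r := by
    rw [avg_keyFun_add]
    have := avg_keyFun_ite (R := R) {r}
    simp only [Finset.mem_singleton, Finset.sum_singleton] at this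
    rw [this, collision]
  have hB : ∀ (Q : Finset (Fin m)) (X : Layer n m → ℝ), (∀ g, 0 ≤ X g) → Q.card ≤ κ - l →
      DependsOn X (Q : Set (Fin m)) →
      E X * (1 * (1 - ((1 / 2) ^ l + absorbed R + keyMass R r + collision R) -
        ∑ r' ∈ Q, (keyMass R r' + if r' = r then (1 : ℝ) else 0))) ≤
      E (fun g => X g * isKey (walk R g l ∅ (.inl r))) := by
    intro Q X hX0 hQ hX
    have h := hE.absorb_le (R := R) hn l ∅ Q (by simp) (.inl r) X hX0 (by omega) hX
    have h2 : (fun g => X g * isKey (walk R g l ∅ (.inl r))) =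
        X - fun g => X g * Sum.elim (fun _ => 0) (fun _ => 1) (walk R g l ∅ (.inl r)) := by
      funext g
      simp only [Pi.sub_apply]
      cases walk R g l ∅ (.inl r) <;> simp [isKey]
    rw [h2, map_sub]
    have h3 : ∑ r' ∈ Q, (if r' = r then (1 : ℝ) else 0) = if r ∈ Q then 1 else 0 := by simp
    rw [Finset.sum_add_distrib, h3]
    simp only [offFresh, keyFun, Sum.elim_inl] at h
    linarith
  have h1 := fun Q X hX0 hQ hX => hE.le_reach_avg (R := R) (l := l) hn (by omega) 1 (fun g => hkey0 _)
    zero_le_one (by positivity) hφ0 hB Q X hX0 hQ hX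
  rw [hφa] at h1
  have h2 := hE.le_reach_avg (R := R) (l := l) (N := κ - 2 * l) hn (by omega) 0
    (B := fun g => mass (nextFate l R g) (.inr 1) * isKey (walk R g l ∅ (.inl r)))
    (fun g => mul_nonneg (mass_nonneg _) (hkey0 _))
    (A := 2 * mass R (.inr 1) * 1) (by positivity)
    (e := (1 / 2) ^ l + absorbed R + keyMass R r + collision R + (collision R + keyMass R r) +
      absorbed R + collision R + (1 / 2) ^ l) (by positivity)
    (φ := fun r' => (keyMass R r' + if r' = r then (1 : ℝ) else 0) + keyMass R r')
    (fun r' => add_nonneg (hφ0 r') (keyMass_nonneg r'))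
    (fun Q X hX0 hQ hX => h1 Q X hX0 (by omega) hX) ∅ (fun _ => 1) (by simp) (by simp; omega)
    (fun _ _ _ => rfl)
  have hφb : avg R (keyFun fun r' => (keyMass R r' + if r' = r then (1 : ℝ) else 0) + keyMass R r')
      = collision R + keyMass R r + collision R := by
    rw [avg_keyFun_add, hφa]
    rfl
  simp only [hE.one, one_mul, hφb, Finset.sum_empty, ← mul_assoc] at h2
  unfold pairMass
  refine le_trans (le_of_eq ?_) h2
  simp only [isKey, keyFun, Sum.elim_inl]
  ring

end OneLayer

instance instDiscreteMeasurableSpaceOptionFin (n : ℕ) : DiscreteMeasurableSpace (Option (Fin n)) :=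
  ⟨fun _ => trivial⟩

section Expect

variable {Ω α β : Type*} [MeasurableSpace Ω] {μ : Measure Ω} [IsProbabilityMeasure μ]
  [MeasurableSpace α] [Finite α] [MeasurableSingletonClass α]
  [MeasurableSpace β] [Finite β] [MeasurableSingletonClass β]

/-- The expectation of functions of a random variable with finitely many values. -/
noncomputable def expect (μ : Measure Ω) [IsProbabilityMeasure μ] (Y : Ω → α) :
    (α → ℝ) →ₗ[ℝ] ℝ where
  toFun F := ∫ a, F a ∂(μ.map Y)
  map_add' _ _ := integral_add Integrable.of_finite Integrable.of_finite
  map_smul' c F := integral_const_mul c F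

theorem expect_apply {Y : Ω → α} (hY : Measurable Y) (F : α → ℝ) :
    expect μ Y F = ∫ ω, F (Y ω) ∂μ :=
  integral_map hY.aemeasurable (Measurable.of_discrete).aestronglyMeasurable

theorem expect_mono {Y : Ω → α} {F G : α → ℝ} (h : ∀ a, F a ≤ G a) :
    expect μ Y F ≤ expect μ Y G :=
  integral_mono Integrable.of_finite Integrable.of_finite h

theorem expect_const {Y : Ω → α} (hY : Measurable Y) (c : ℝ) :
    expect μ Y (fun _ => c) = c := by
  rw [expect_apply hY]
  simp

theorem expect_ite {Y : Ω → α} (hY : Measurable Y) (p : α → Prop) [DecidablePred p] :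
    expect μ Y (fun a => if p a then 1 else 0) = μ.real {ω | p (Y ω)} := by
  have h : MeasurableSet {ω | p (Y ω)} := hY (Set.toFinite {a | p a}).measurableSet
  rw [expect_apply hY, ← integral_indicator_one h]
  congr 1
  funext ω
  simp [Set.indicator_apply]

theorem expect_indep {X : Ω → α} {Y : Ω → β} (hX : Measurable X) (hY : Measurable Y)
    (h : IndepFun X Y μ) (F : α → β → ℝ) :
    ∫ ω, F (X ω) (Y ω) ∂μ = expect μ X fun a => expect μ Y (F a) := by
  have h1 : ∫ ω, F (X ω) (Y ω) ∂μ = expect μ (fun ω => (X ω, Y ω)) fun z => F z.1 z.2 :=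
    (expect_apply (hX.prodMk hY) fun z : α × β => F z.1 z.2).symm
  rw [h1]
  change ∫ z, F z.1 z.2 ∂(μ.map fun ω => (X ω, Y ω)) = _
  have : IsProbabilityMeasure (μ.map X) := Measure.isProbabilityMeasure_map hX.aemeasurable
  have : IsProbabilityMeasure (μ.map Y) := Measure.isProbabilityMeasure_map hY.aemeasurable
  rw [(indepFun_iff_map_prod_eq_prod_map_map hX.aemeasurable hY.aemeasurable).1 h,
    integral_prod _ Integrable.of_finite]
  rfl

end Expect

section Layers

variable {Ω : Type*} [MeasurableSpace Ω] {μ : Measure Ω} [IsProbabilityMeasure μ] {n m κ : ℕ}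

theorem IsLayer.expect_fresh {g : Ω → Fin m → Option (Fin n)} (hg : IsLayer μ κ g)
    (Q : Finset (Fin m)) (r : Fin m) (X : Layer n m → ℝ) (a : Option (Fin n)) (hQ : Q.card < κ)
    (hr : r ∉ Q) (hX : DependsOn X (Q : Set (Fin m))) :
    expect μ g (fun g' => X g' * if g' r = a then 1 else 0) =
      expect μ g X * μ.real {ω | g ω r = a} := by
  classical
  have hmeas : ∀ j, Measurable fun ω => g ω j := fun j => (measurable_pi_apply j).comp hg.measurable
  have hind := hg.kwise (insert r Q) (by rw [Finset.card_insert_of_notMem hr]; omega)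
  let r' : (insert r Q : Finset (Fin m)) := ⟨r, by simp⟩
  have h2 := hind.indepFun_finset (Finset.univ \ {r'}) {r'} Finset.sdiff_disjoint fun j => hmeas j
  let Φ : (((Finset.univ \ {r'} : Finset (insert r Q : Finset (Fin m)))) → Option (Fin n)) → ℝ :=
    fun z => X fun j => if h : j ∈ Q then z ⟨⟨j, by simp [h]⟩, by
      simp only [Finset.mem_sdiff, Finset.mem_univ, Finset.mem_singleton, true_and, r']
      intro h'
      exact hr (by simpa [← (Subtype.mk.inj h')] using h)⟩ else none
  let Ψ : (({r'} : Finset (insert r Q : Finset (Fin m))) → Option (Fin n)) → ℝ :=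
    fun z => if z ⟨r', by simp⟩ = a then 1 else 0
  have h3 := (h2.comp (φ := Φ) (ψ := Ψ) Measurable.of_discrete
    Measurable.of_discrete).integral_fun_mul_eq_mul_integral ?_ ?_
  rotate_left
  · exact (Measurable.of_discrete.comp (measurable_pi_lambda _ fun j => hmeas _)).aestronglyMeasurable
  · exact (Measurable.of_discrete.comp (measurable_pi_lambda _ fun j => hmeas _)).aestronglyMeasurable
  have hΦ : ∀ ω, Φ (fun j => g ω j) = X (g ω) := fun ω => hX fun j hj => by
    have : j ∈ Q := hj
    simp [this]
  rw [expect_apply hg.measurable, expect_apply hg.measurable, ← expect_ite (hmeas r) (fun b => b = a),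
    expect_apply (hmeas r)]
  simp only [Function.comp_def, hΦ] at h3
  exact h3

theorem IsLayer.isKWise {g : Ω → Fin m → Option (Fin n)} (hg : IsLayer μ κ g) :
    IsKWise κ (expect μ g) where
  nonneg F hF := integral_nonneg hF
  one := expect_const hg.measurable 1
  fresh_none Q r X hQ hr hX := by
    rw [hg.expect_fresh Q r X none hQ hr hX, hg.prob_none]
    ring
  fresh_some Q r X y hQ hr hX := by
    rw [hg.expect_fresh Q r X (some y) hQ hr hX, hg.prob_some]
    ring

/-- The fates of all vertices, and the fate of a distinguished path, after the first `i` layers. -/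
def fates (l : ℕ) (R₀ : Fin n → Fate m) (ρ₀ : Fate m) (η : ℕ → Layer n m) :
    ℕ → (Fin n → Fate m) × Fate m
  | 0 => (R₀, ρ₀)
  | i + 1 => (nextFate l (fates l R₀ ρ₀ η i).1 (η i), walk (fates l R₀ ρ₀ η i).1 (η i) l ∅
      (fates l R₀ ρ₀ η i).2)

/-- Extension of a finite sequence of layers by empty layers. -/
def extend {t : ℕ} (η : Fin t → Layer n m) (i : ℕ) : Layer n m :=
  if hi : i < t then η ⟨i, hi⟩ else fun _ => none

theorem fates_congr (l : ℕ) (R₀ : Fin n → Fate m) (ρ₀ : Fate m) {η η' : ℕ → Layer n m} {i : ℕ}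
    (h : ∀ j < i, η j = η' j) : fates l R₀ ρ₀ η i = fates l R₀ ρ₀ η' i := by
  induction i with
  | zero => rfl
  | succ i ih => simp only [fates, ih fun j hj => h j (by omega), h i (by omega)]

theorem expect_fates_layer {t : ℕ} {h : Fin t → Ω → Fin m → Option (Fin n)}
    (hm : ∀ q, Measurable (h q)) (hind : iIndepFun h μ) (l : ℕ) (R₀ : Fin n → Fate m)
    (ρ₀ : Fate m) (i : Fin t) (F : (Fin n → Fate m) × Fate m → Layer n m → ℝ) :
    expect μ (fun ω q => h q ω) (fun η => F (fates l R₀ ρ₀ (extend η) i) (η i)) =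
      expect μ (fun ω q => h q ω) fun η => expect μ (h i) (F (fates l R₀ ρ₀ (extend η) i)) := by
  classical
  have hH : Measurable fun ω q => h q ω := measurable_pi_lambda _ hm
  let S : Finset (Fin t) := Finset.univ.filter (· < i)
  have h2 := (hind.indepFun_finset S {i} (by simp [S]) hm).comp
    (φ := id) (ψ := fun z => z ⟨i, by simp⟩) measurable_id Measurable.of_discrete
  let Φ : (S → Layer n m) → (Fin n → Fate m) × Fate m := fun z => fates l R₀ ρ₀
    (extend fun q => if hq : q ∈ S then z ⟨q, hq⟩ else fun _ => none) i
  have hΦ : ∀ η : Fin t → Layer n m, Φ (fun q => η q) = fates l R₀ ρ₀ (extend η) i := fun η => by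
    refine fates_congr l R₀ ρ₀ fun j hj => ?_
    have hjt : j < t := hj.trans i.2
    have hjS : (⟨j, hjt⟩ : Fin t) ∈ S := Finset.mem_filter.2 ⟨Finset.mem_univ _, hj⟩
    simp [extend, hjt, hjS]
  have hS : Measurable fun ω (q : S) => h q ω := measurable_pi_lambda _ fun q => hm q
  have h3 := expect_indep (α := S → Layer n m) hS (hm i) h2 fun z g => F (Φ z) g
  rw [expect_apply hS] at h3
  rw [expect_apply hH, expect_apply hH]
  simp only [← hΦ]
  exact h3

end Layers

section Soundness

variable {n m : ℕ}

/-- The hash combined from the first `i` layers. -/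
def partialHash (η : ℕ → Layer n m) : ℕ → Layer n m
  | 0 => fun _ => none
  | i + 1 => fun r => (partialHash η i r).or (η i r)

theorem partialHash_eq_some {η : ℕ → Layer n m} {i : ℕ} {r : Fin m} {y : Fin n}
    (h : partialHash η i r = some y) : ∃ q < i, η q r = some y ∧ ∀ q' < q, η q' r = none := by
  suffices H : (∀ y, partialHash η i r = some y →
      ∃ q < i, η q r = some y ∧ ∀ q' < q, η q' r = none) ∧
      (partialHash η i r = none → ∀ q < i, η q r = none) from H.1 y h
  clear h
  induction i with
  | zero => simp [partialHash]
  | succ i ih =>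
    simp only [partialHash]
    cases hp : partialHash η i r with
    | none =>
      simp only [Option.none_or]
      have h0 := ih.2 hp
      refine ⟨fun y hy => ⟨i, by omega, hy, h0⟩, fun hi q hq => ?_⟩
      rcases Nat.lt_succ_iff_lt_or_eq.1 hq with hq | rfl
      · exact h0 q hq
      · exact hi
    | some z =>
      simp only [Option.some_or, Option.some.injEq, reduceCtorEq, false_implies, and_true]
      rintro y rfl
      obtain ⟨q, hq, h⟩ := ih.1 z hp
      exact ⟨q, by omega, h⟩

theorem combine_eq_some {t : ℕ} {η : Fin t → Layer n m} {i : ℕ} {r : Fin m} {y : Fin n}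
    (h : partialHash (extend η) i r = some y) : combine η r = some y := by
  obtain ⟨q, -, hq, hq'⟩ := partialHash_eq_some h
  have hqt : q < t := by
    by_contra hqt
    simp [extend, hqt] at hq
  refine Fin.findSome?_eq_some_iff.2 ⟨⟨q, hqt⟩, by simpa [extend, hqt] using hq, fun j hj => ?_⟩
  simpa [extend, j.2] using hq' j hj

/-- Reachability in the digraph of a hash. -/
abbrev Reach (a : Fin n → Fin m) (f : Layer n m) : Fin n → Fin n → Prop :=
  Relation.ReflTransGen (graph a f).Adj

theorem Reach.mono {a : Fin n → Fin m} {f f' : Layer n m}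
    (h : ∀ r y, f r = some y → f' r = some y) {x y : Fin n} (hxy : Reach a f x y) :
    Reach a f' x y :=
  Relation.ReflTransGen.mono (fun x y hxy => h (a x) y hxy) _ _ hxy

/-- The fate `c` of `x` is correct in the digraph of `f`, for the targets `u` and `v`. -/
def Sound (a : Fin n → Fin m) (u v : Fin n) (f : Layer n m) (x : Fin n) (c : Fate m) : Prop :=
  (∀ r, c = .inl r → f r = none ∧ ∃ y, Reach a f x y ∧ a y = r) ∧
    (c = .inr 0 → Reach a f x u) ∧ (c = .inr 1 → Reach a f x v)

theorem Sound.walk {a : Fin n → Fin m} {u v : Fin n} {f g : Layer n m} {R : Fin n → Fate m}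
    (hR : ∀ y, Sound a u v f y (R y)) {x : Fin n} (j : ℕ) (S : Finset (Fin m)) (z : Fin n)
    (c : Fate m) (hxz : Reach a (fun r => (f r).or (g r)) x z) (hc : Sound a u v f z c) :
    Sound a u v (fun r => (f r).or (g r)) x (LayeredHash.walk R g j S c) := by
  have hmono : ∀ r y, f r = some y → (f r).or (g r) = some y := fun r y h => by simp [h]
  induction j generalizing S z c with
  | zero =>
    rcases c with r | i
    · simp [Sound]
    · rw [walk_inr]
      exact ⟨by simp, fun h => hxz.trans ((hc.2.1 h).mono hmono),
        fun h => hxz.trans ((hc.2.2 h).mono hmono)⟩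
  | succ j ih =>
    rcases c with r | i
    · by_cases hS : r ∈ S
      · rw [walk_mem g _ hS]
        simp [Sound]
      obtain ⟨hf, y, hzy, hy⟩ := hc.1 r rfl
      have hxy := hxz.trans (hzy.mono hmono)
      cases hg : g r with
      | none =>
        simp only [LayeredHash.walk, if_neg hS, hg]
        refine ⟨fun r' h => ?_, by simp, by simp⟩
        obtain rfl := Sum.inl.inj h
        exact ⟨by simp [hf, hg], y, hxy, hy⟩
      | some w =>
        simp only [LayeredHash.walk, if_neg hS, hg]
        refine ih (insert r S) w (R w) (hxy.tail ?_) (hR w)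
        simp [graph, hy, hf, hg]
    · rw [walk_inr]
      exact ⟨by simp, fun h => hxz.trans ((hc.2.1 h).mono hmono),
        fun h => hxz.trans ((hc.2.2 h).mono hmono)⟩

/-- The fates in the empty hash: the targets are `u` and `v`. -/
def initFate (a : Fin n → Fin m) (u v : Fin n) (x : Fin n) : Fate m :=
  if x = u then .inr 0 else if x = v then .inr 1 else .inl (a x)

theorem sound_fates (a : Fin n → Fin m) (u v : Fin n) (l : ℕ) (η : ℕ → Layer n m) (i : ℕ) :
    (∀ x, Sound a u v (partialHash η i) x
      ((fates l (initFate a u v) (.inl (a u)) η i).1 x)) ∧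
    Sound a u v (partialHash η i) u (fates l (initFate a u v) (.inl (a u)) η i).2 := by
  induction i with
  | zero =>
    refine ⟨fun x => ?_, ?_⟩
    · simp only [fates, initFate]
      split_ifs with h1 h2
      · subst h1
        exact ⟨by simp, fun _ => .refl, by simp⟩
      · subst h2
        exact ⟨by simp, by simp, fun _ => .refl⟩
      · refine ⟨fun r hr => ⟨rfl, x, .refl, Sum.inl.inj hr⟩, by simp, by simp⟩
    · exact ⟨fun r hr => ⟨rfl, u, .refl, Sum.inl.inj hr⟩, by simp [fates], by simp [fates]⟩
  | succ i ih =>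
    exact ⟨fun x => Sound.walk ih.1 l ∅ x _ .refl (ih.1 x), Sound.walk ih.1 l ∅ u _ .refl ih.2⟩

end Soundness

section Initial

variable {n m : ℕ} {a : Fin n → Fin m} {u v : Fin n}

theorem pairMass_initFate (huv : u ≠ v) : pairMass (initFate a u v) = 1 / (n : ℝ) ^ 2 := by
  have h0 : mass (initFate a u v) (.inr 0) = 1 / n := by
    have : ∀ y, (initFate a u v y = .inr 0) ↔ y = u := fun y => by
      unfold initFate
      split_ifs <;> simp_all
    simp [mass, avg, this]
  have h1 : mass (initFate a u v) (.inr 1) = 1 / n := by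
    have : ∀ y, (initFate a u v y = .inr 1) ↔ y = v := fun y => by
      unfold initFate
      split_ifs <;> simp_all
    simp [mass, avg, this]
  rw [pairMass, h0, h1]
  ring

theorem absorbed_initFate (huv : u ≠ v) : absorbed (initFate a u v) = 2 / n := by
  have : ∀ y, Sum.elim (fun _ => (0 : ℝ)) (fun _ => 1) (initFate a u v y) =
      (if y = u then 1 else 0) + if y = v then 1 else 0 := fun y => by
    unfold initFate
    split_ifs <;> simp_all
  simp only [absorbed, avg, this, Finset.sum_add_distrib, Finset.sum_ite_eq', Finset.mem_univ,
    if_true]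
  norm_num

theorem collision_initFate_le : collision (initFate a u v) ≤ (F2 a : ℝ) / (n : ℝ) ^ 2 := by
  have key : ∀ x r, initFate a u v x = .inl r → a x = r := fun x r h => by
    unfold initFate at h
    split_ifs at h
    exact Sum.inl.inj h
  have hF : (F2 a : ℝ) / (n : ℝ) ^ 2 = (∑ y, (∑ x, if a y = a x then (1 : ℝ) else 0) / n) / n := by
    rw [← Finset.sum_div, div_div, sq, F2]
    push_cast
    rfl
  rw [hF, collision, avg]
  refine div_le_div_of_nonneg_right (Finset.sum_le_sum fun y _ => ?_) (Nat.cast_nonneg n)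
  cases hy : initFate a u v y with
  | inr i =>
    simp only [keyFun, Sum.elim_inr]
    positivity
  | inl r =>
    simp only [keyFun, Sum.elim_inl, keyMass, mass, avg]
    refine div_le_div_of_nonneg_right (Finset.sum_le_sum fun x _ => ?_) (Nat.cast_nonneg n)
    split_ifs with h1 h2
    · exact le_rfl
    · exact absurd ((key y r hy).trans (key x r h1).symm) h2
    · exact zero_le_one
    · exact le_rfl

theorem le_F2 (a : Fin n → Fin m) : n ≤ F2 a := by
  calc n = ∑ i : Fin n, 1 := by simp
    _ ≤ F2 a := Finset.sum_le_sum fun i _ => by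
      have := Finset.single_le_sum (f := fun j => if a i = a j then 1 else 0)
        (fun _ _ => Nat.zero_le _) (Finset.mem_univ i)
      simpa using this

theorem keyMass_sq_le_collision {R : Fin n → Fate m} (r : Fin m) :
    keyMass R r ^ 2 ≤ collision R := by
  rw [collision_eq_sum_sq]
  exact Finset.single_le_sum (f := fun r => keyMass R r ^ 2) (fun _ _ => sq_nonneg _)
    (Finset.mem_univ r)

end Initial

/-- Solution of the recursive inequalities for the moments of the fates. -/
theorem moment_bounds {t : ℕ} {e A B Z Φ : ℕ → ℝ} {c V σ ε : ℝ} (hc : 0 ≤ c) (hV : 0 ≤ V)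
    (hεV : ε ≤ V) (hε : 0 ≤ ε)
    (e0 : e 0 ≤ c) (A0 : A 0 ≤ c * V) (B0 : B 0 ≤ c * (2 * V)) (Z0 : Z 0 ≤ c * σ) (hΦ0 : c ≤ Φ 0)
    (hσ : 0 ≤ σ)
    (he : ∀ i < t, e (i + 1) ≤ 4 * e i) (hA : ∀ i < t, A (i + 1) ≤ 16 * A i)
    (hB : ∀ i < t, B (i + 1) ≤ 8 * B i + 24 * A i + 4 * ε * e i)
    (hZ : ∀ i < t, Z (i + 1) ≤ 8 * Z i + 8 * A i)
    (hΦ : ∀ i < t, 4 * Φ i - 4 * (3 * ε * e i + 3 * B i + 3 * Z i + 6 * A i) ≤ Φ (i + 1))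
    {i : ℕ} (hi : i ≤ t) :
    B i ≤ c * (4 * (4 ^ i * 4 ^ i) * V) ∧
      c * (4 ^ i * (1 - 8 * 4 ^ i * V - 3 * 2 ^ i * σ)) ≤ Φ i := by
  suffices H : e i ≤ c * 4 ^ i ∧ A i ≤ c * (4 ^ i * 4 ^ i * V) ∧
      B i ≤ c * (4 * (4 ^ i * 4 ^ i) * V) ∧
      Z i ≤ c * (4 ^ i * 2 ^ i * σ + 4 ^ i * 4 ^ i * V) ∧
      c * (4 ^ i * (1 - 8 * 4 ^ i * V - 3 * 2 ^ i * σ)) ≤ Φ i from ⟨H.2.2.1, H.2.2.2.2⟩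
  induction i with
  | zero =>
    have h1 : 0 ≤ c * V := mul_nonneg hc hV
    have h2 : 0 ≤ c * σ := mul_nonneg hc hσ
    refine ⟨by simpa using e0, by simpa using A0, ?_, ?_, ?_⟩ <;> simp only [pow_zero] <;> nlinarith
  | succ i ih =>
    obtain ⟨h1, h2, h3, h4, h5⟩ := ih (by omega)
    have hi' : i < t := by omega
    have p4 : (1 : ℝ) ≤ 4 ^ i := one_le_pow₀ (by norm_num)
    have p0 : (0 : ℝ) ≤ 4 ^ i := by positivity
    have hee : ε * e i ≤ c * (4 ^ i * 4 ^ i * V) := by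
      calc ε * e i ≤ ε * (c * 4 ^ i) := mul_le_mul_of_nonneg_left h1 hε
        _ ≤ V * (c * 4 ^ i) := mul_le_mul_of_nonneg_right hεV (by positivity)
        _ = c * (1 * 4 ^ i * V) := by ring
        _ ≤ c * (4 ^ i * 4 ^ i * V) := by gcongr
    have hx : 0 ≤ c * (4 ^ i * 4 ^ i * V) := by positivity
    rw [pow_succ (4 : ℝ), pow_succ (2 : ℝ)]
    refine ⟨?_, ?_, ?_, ?_, ?_⟩
    · linarith [he i hi']
    · linarith [hA i hi']
    · linarith [hB i hi']
    · linarith [hZ i hi']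
    · linarith [hΦ i hi']

section Measurability

variable {Ω : Type*} [MeasurableSpace Ω] {μ : Measure Ω}
  {n m t k κ : ℕ} {h : Fin t → Ω → Fin m → Option (Fin n)} {x : Fin k → Ω → Fin n}

theorem IsSample.measurable_layers (hs : IsSample μ κ h x) : Measurable fun ω q => h q ω :=
  measurable_pi_lambda _ fun q => (hs.layer q).measurable

theorem IsSample.measurable_starts (hs : IsSample μ κ h x) : Measurable fun ω i => x i ω :=
  measurable_pi_lambda _ hs.start_measurable

end Measurability

section Moments

variable {Ω : Type*} [MeasurableSpace Ω] {μ : Measure Ω} [IsProbabilityMeasure μ]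
  {n m t k κ : ℕ} {h : Fin t → Ω → Fin m → Option (Fin n)} {x : Fin k → Ω → Fin n}

theorem IsSample.expect_fates_succ (hs : IsSample μ κ h x) (l : ℕ) (R₀ : Fin n → Fate m)
    (ρ₀ : Fate m) {i : ℕ} (hi : i < t) (F : (Fin n → Fate m) × Fate m → ℝ) :
    expect μ (fun ω q => h q ω) (fun η => F (fates l R₀ ρ₀ (extend η) (i + 1))) =
      expect μ (fun ω q => h q ω) fun η => expect μ (h ⟨i, hi⟩) fun g =>
        F (nextFate l (fates l R₀ ρ₀ (extend η) i).1 g,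
          walk (fates l R₀ ρ₀ (extend η) i).1 g l ∅ (fates l R₀ ρ₀ (extend η) i).2) := by
  rw [← expect_fates_layer (fun q => (hs.layer q).measurable) hs.layers_indep l R₀ ρ₀ ⟨i, hi⟩
    fun s g => F (nextFate l s.1 g, walk s.1 g l ∅ s.2)]
  have : ∀ η : Fin t → Layer n m, extend η i = η ⟨i, hi⟩ := fun η => by simp [extend, hi]
  simp only [fates, this]

/-- Bounds for the moments of the fates after `i` layers. -/
theorem IsSample.fates_moments (hs : IsSample μ κ h x) (hn : 0 < n) (a : Fin n → Fin m)
    {u v : Fin n} (huv : u ≠ v) {l : ℕ} (hl : 4 * l ≤ κ) (hln : (1 / 2 : ℝ) ^ l ≤ 1 / n)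
    {i : ℕ} (hi : i ≤ t) :
    expect μ (fun ω q => h q ω) (fun η =>
        pairMass (fates l (initFate a u v) (.inl (a u)) (extend η) i).1 *
          absorbed (fates l (initFate a u v) (.inl (a u)) (extend η) i).1) ≤
      1 / (n : ℝ) ^ 2 * (4 * (4 ^ i * 4 ^ i) * ((F2 a : ℝ) / (n : ℝ) ^ 2)) ∧
    1 / (n : ℝ) ^ 2 * (4 ^ i * (1 - 8 * 4 ^ i * ((F2 a : ℝ) / (n : ℝ) ^ 2) -
        3 * 2 ^ i * √((F2 a : ℝ) / (n : ℝ) ^ 2))) ≤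
      expect μ (fun ω q => h q ω) (fun η =>
        pairMass (fates l (initFate a u v) (.inl (a u)) (extend η) i).1 *
          isKey (fates l (initFate a u v) (.inl (a u)) (extend η) i).2) := by
  set s : ℕ → (Fin t → Layer n m) → (Fin n → Fate m) × Fate m :=
    fun i η => fates l (initFate a u v) (.inl (a u)) (extend η) i with hsdef
  set H := expect μ (fun ω q => h q ω) with hH
  have hn' : (0 : ℝ) < n := by exact_mod_cast hn
  have hV : 1 / (n : ℝ) ≤ (F2 a : ℝ) / (n : ℝ) ^ 2 := by
    rw [div_le_div_iff₀ hn' (by positivity), one_mul, sq]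
    have : (n : ℝ) ≤ F2 a := by exact_mod_cast le_F2 a
    gcongr
  have hconst : ∀ c : ℝ, H (fun _ => c) = c := expect_const hs.measurable_layers
  have hK := fun q => (hs.layer q).isKWise
  have hcol : collision (initFate a u v) ≤ (F2 a : ℝ) / (n : ℝ) ^ 2 := collision_initFate_le
  have hc : (0 : ℝ) ≤ 1 / (n : ℝ) ^ 2 := by positivity
  have hlin1 : ∀ (c : ℝ) (F : (Fin t → Layer n m) → ℝ), H (fun η => c * F η) = c * H F :=
    fun c F => H.map_smul c F
  have hlin2 : ∀ F G : (Fin t → Layer n m) → ℝ, H (fun η => F η + G η) = H F + H G :=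
    fun F G => H.map_add F G
  have hlin3 : ∀ F G : (Fin t → Layer n m) → ℝ, H (fun η => F η - G η) = H F - H G :=
    fun F G => H.map_sub F G
  refine moment_bounds (t := t) (e := fun i => H fun η => pairMass (s i η).1)
    (A := fun i => H fun η => pairMass (s i η).1 * collision (s i η).1)
    (B := fun i => H fun η => pairMass (s i η).1 * absorbed (s i η).1)
    (Z := fun i => H fun η => pairMass (s i η).1 * keyFun (keyMass (s i η).1) (s i η).2)
    (Φ := fun i => H fun η => pairMass (s i η).1 * isKey (s i η).2)
    (ε := (1 / 2) ^ l) hc (by positivity) (hln.trans hV) (by positivity)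
    ?_ ?_ ?_ ?_ ?_ (Real.sqrt_nonneg _) ?_ ?_ ?_ ?_ ?_ hi
  · simp only [hsdef, fates, hconst, pairMass_initFate huv, le_refl]
  · simp only [hsdef, fates, hconst, pairMass_initFate huv]
    exact mul_le_mul_of_nonneg_left hcol hc
  · simp only [hsdef, fates, hconst, pairMass_initFate huv, absorbed_initFate huv]
    refine mul_le_mul_of_nonneg_left ?_ hc
    rw [show (2 : ℝ) / n = 2 * (1 / n) by ring]
    linarith
  · simp only [hsdef, fates, hconst, pairMass_initFate huv, keyFun, Sum.elim_inl]
    exact mul_le_mul_of_nonneg_left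
      (Real.le_sqrt_of_sq_le ((keyMass_sq_le_collision _).trans hcol)) hc
  · simp only [hsdef, fates, hconst, pairMass_initFate huv, isKey, Sum.elim_inl, mul_one, le_refl]
  · intro i hi
    simp only [hsdef]
    rw [hs.expect_fates_succ l _ _ hi fun s => pairMass s.1, ← hlin1]
    exact expect_mono fun η => (hK ⟨i, hi⟩).map_pairMass_le hn hl
  · intro i hi
    simp only [hsdef]
    rw [hs.expect_fates_succ l _ _ hi fun s => pairMass s.1 * collision s.1, ← hlin1]
    exact expect_mono fun η => (hK ⟨i, hi⟩).map_collision_le hn hl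
  · intro i hi
    simp only [hsdef]
    rw [hs.expect_fates_succ l _ _ hi fun s => pairMass s.1 * absorbed s.1, ← hlin1, ← hlin1,
      ← hlin1, ← hlin2, ← hlin2]
    exact expect_mono fun η => (hK ⟨i, hi⟩).map_absorbed_le hn hl
  · intro i hi
    simp only [hsdef]
    rw [hs.expect_fates_succ l _ _ hi fun s => pairMass s.1 * keyFun (keyMass s.1) s.2, ← hlin1,
      ← hlin1, ← hlin2]
    exact expect_mono fun η => (hK ⟨i, hi⟩).map_meet_le hn hl _
  · intro i hi
    simp only [hsdef]
    rw [hs.expect_fates_succ l _ _ hi fun s => pairMass s.1 * isKey s.2]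
    simp only [← hlin1, ← hlin2, ← hlin3]
    exact expect_mono fun η => (hK ⟨i, hi⟩).le_map_isKey hn hl _

end Moments

section Starts

variable {Ω : Type*} [MeasurableSpace Ω] {μ : Measure Ω} [IsProbabilityMeasure μ]
  {n m t k κ : ℕ} {h : Fin t → Ω → Fin m → Option (Fin n)} {x : Fin k → Ω → Fin n}

theorem IsSample.prob_fate (hs : IsSample μ κ h x) (R : Fin n → Fate m) (c : Fate m) (i : Fin k) :
    μ.real {ω | R (x i ω) = c} = mass R c := by
  rw [← expect_ite (hs.start_measurable i) fun y => R y = c]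
  change ∫ y, _ ∂(μ.map (x i)) = _
  have : IsProbabilityMeasure (μ.map (x i)) :=
    Measure.isProbabilityMeasure_map (hs.start_measurable i).aemeasurable
  rw [integral_fintype Integrable.of_finite]
  have h1 : ∀ y, (μ.map (x i)).real {y} = 1 / n := fun y => by
    rw [map_measureReal_apply (hs.start_measurable i) (measurableSet_singleton y)]
    exact hs.start_uniform i y
  simp only [h1, smul_eq_mul, ← Finset.mul_sum, mass, avg]
  ring

theorem IsSample.prob_avoid (hs : IsSample μ κ h x) (R : Fin n → Fate m) (S : Finset (Fin k))
    (c : Fin k → Fate m) :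
    μ.real {ω | ∀ i ∈ S, R (x i ω) ≠ c i} = ∏ i ∈ S, (1 - mass R (c i)) := by
  have h1 := hs.starts_indep.measure_inter_preimage_eq_mul S (sets := fun i => {y | R y ≠ c i})
    fun i _ => (Set.toFinite _).measurableSet
  have h2 : {ω | ∀ i ∈ S, R (x i ω) ≠ c i} = ⋂ i ∈ S, x i ⁻¹' {y | R y ≠ c i} := by
    ext ω; simp
  rw [h2, measureReal_def, h1, ENNReal.toReal_prod]
  refine Finset.prod_congr rfl fun i _ => ?_
  rw [← hs.prob_fate R (c i) i]
  have h3 : x i ⁻¹' {y | R y ≠ c i} = {ω | R (x i ω) = c i}ᶜ := rfl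
  rw [← measureReal_def, h3, probReal_compl_eq_one_sub]
  exact hs.start_measurable i (Set.toFinite {y | R y = c i}).measurableSet

theorem one_sub_pow_le {p : ℝ} (hp0 : 0 ≤ p) (hp1 : p ≤ 1) (k : ℕ) :
    (1 - p) ^ k ≤ 1 - k * p + (k * p) ^ 2 / 2 := by
  induction k with
  | zero => simp
  | succ k ih =>
    have h1 : (1 - p) ^ (k + 1) ≤ (1 - k * p + (k * p) ^ 2 / 2) * (1 - p) := by
      rw [pow_succ]; exact mul_le_mul_of_nonneg_right ih (by linarith)
    have h2 : 0 ≤ (k * p) ^ 2 * p := by positivity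
    push_cast
    nlinarith [sq_nonneg p]

theorem mass_le_one {R : Fin n → Fate m} (hn : 0 < n) (c : Fate m) : mass R c ≤ 1 := by
  refine (avg_mono fun c' => ?_).trans (avg_const (R := R) hn 1).le
  split_ifs <;> simp

theorem pairs_le {p q : ℝ} (hp0 : 0 ≤ p) (hp1 : p ≤ 1) (hq0 : 0 ≤ q) (hq1 : q ≤ 1) (k : ℕ) :
    (k : ℝ) ^ 2 * (p * q * (1 - k / 2 * (p + q))) ≤ (1 - (1 - p) ^ k) * (1 - (1 - q) ^ k) := by
  have hp := one_sub_pow_le hp0 hp1 k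
  have hq := one_sub_pow_le hq0 hq1 k
  have hp' : (1 - p) ^ k ≤ 1 := pow_le_one₀ (by linarith) (by linarith)
  have hq' : (1 - q) ^ k ≤ 1 := pow_le_one₀ (by linarith) (by linarith)
  set y := k * p with hy
  set z := k * q with hz
  have hy0 : 0 ≤ y := by positivity
  have hz0 : 0 ≤ z := by positivity
  have e1 : (k : ℝ) ^ 2 * (p * q * (1 - k / 2 * (p + q))) = y * z * (1 - (y + z) / 2) := by
    rw [hy, hz]; ring
  rw [e1]
  by_cases hyz : 2 ≤ y + z
  · refine le_trans ?_ (mul_nonneg (sub_nonneg.2 hp') (sub_nonneg.2 hq'))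
    exact mul_nonpos_of_nonneg_of_nonpos (by positivity) (by linarith)
  · push Not at hyz
    calc y * z * (1 - (y + z) / 2) ≤ (y * (1 - y / 2)) * (z * (1 - z / 2)) := by
          nlinarith [mul_nonneg (mul_nonneg hy0 hz0) (mul_nonneg hy0 hz0)]
      _ ≤ _ := by
          refine mul_le_mul (by nlinarith) (by nlinarith) ?_ (by linarith)
          exact mul_nonneg hz0 (by linarith)

theorem IsSample.prob_pair (hs : IsSample μ κ h x) (hn : 0 < n) (R : Fin n → Fate m) {j : ℕ}
    (hj : 2 * j ≤ k) :
    (j : ℝ) ^ 2 * (pairMass R * (1 - j / 2 * (mass R (.inr 0) + mass R (.inr 1)))) ≤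
      μ.real {ω | (∃ i, R (x i ω) = .inr 0) ∧ ∃ i, R (x i ω) = .inr 1} := by
  refine (pairs_le (mass_nonneg _) (mass_le_one hn _) (mass_nonneg _) (mass_le_one hn _) j).trans ?_
  let S : Finset (Fin k) := Finset.univ.filter fun i => i.1 < j
  let T : Finset (Fin k) := Finset.univ.filter fun i => j ≤ i.1 ∧ i.1 < 2 * j
  have hS : S.card = j := by
    rw [Fin.card_filter_val_lt]; omega
  have hdis : Disjoint S T := Finset.disjoint_left.2 fun i h1 h2 => by
    simp [S, T] at h1 h2; omega
  have hU : S ∪ T = Finset.univ.filter fun i => i.1 < 2 * j := by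
    ext i; simp [S, T]; omega
  have hT : T.card = j := by
    have := Finset.card_union_of_disjoint hdis
    rw [hU, Fin.card_filter_val_lt, hS] at this
    omega
  let c : Fin k → Fate m := fun i => if i.1 < j then .inr 0 else .inr 1
  have hcS : ∀ i ∈ S, c i = .inr 0 := fun i hi => by simp [S] at hi; simp [c, hi]
  have hcT : ∀ i ∈ T, c i = .inr 1 := fun i hi => by simp [T] at hi; simp [c, hi]
  have pS := hs.prob_avoid R S c
  have pT := hs.prob_avoid R T c
  have pU := hs.prob_avoid R (S ∪ T) c
  rw [Finset.prod_union hdis] at pU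
  rw [Finset.prod_congr rfl fun i hi => by rw [hcS i hi], Finset.prod_const, hS] at pS pU
  rw [Finset.prod_congr rfl fun i hi => by rw [hcT i hi], Finset.prod_const, hT] at pT pU
  set AS := {ω | ∀ i ∈ S, R (x i ω) ≠ c i} with hAS
  set AT := {ω | ∀ i ∈ T, R (x i ω) ≠ c i} with hAT
  have hmeas : ∀ S : Finset (Fin k), MeasurableSet {ω | ∀ i ∈ S, R (x i ω) ≠ c i} := fun S =>
    hs.measurable_starts (Set.toFinite {ξ : Fin k → Fin n | ∀ i ∈ S, R (ξ i) ≠ c i}).measurableSet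
  have hinter : {ω | ∀ i ∈ S ∪ T, R (x i ω) ≠ c i} = AS ∩ AT := by
    ext ω
    simp only [Finset.mem_union, Set.mem_ofPred_eq, Set.mem_inter_iff, hAS, hAT]
    exact ⟨fun h => ⟨fun i hi => h i (Or.inl hi), fun i hi => h i (Or.inr hi)⟩,
      fun h i hi => hi.elim (h.1 i) (h.2 i)⟩
  rw [hinter] at pU
  have hun := measureReal_union_add_inter (μ := μ) (s := AS) (t := AT) (hmeas T)
  have hcompl := probReal_compl_eq_one_sub (μ := μ) ((hmeas S).union (hmeas T))
  calc (1 - (1 - mass R (.inr 0)) ^ j) * (1 - (1 - mass R (.inr 1)) ^ j)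
      = μ.real (AS ∪ AT)ᶜ := by
        rw [hcompl]
        have : μ.real (AS ∪ AT) = μ.real AS + μ.real AT - μ.real (AS ∩ AT) := by linarith
        rw [this, pS, pT, pU]
        ring
    _ ≤ _ := by
        refine measureReal_mono fun ω hω => ?_
        simp only [Set.compl_union, Set.mem_inter_iff, Set.mem_compl_iff, hAS, hAT,
          Set.mem_ofPred_eq, not_forall, not_not] at hω
        obtain ⟨⟨i, hi, h1⟩, ⟨i', hi', h2⟩⟩ := hω
        exact ⟨⟨i, h1.trans (hcS i hi)⟩, ⟨i', h2.trans (hcT i' hi')⟩⟩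

end Starts

section Assembly

variable {Ω : Type*} [MeasurableSpace Ω] {μ : Measure Ω} [IsProbabilityMeasure μ]
  {n m t k κ : ℕ} {h : Fin t → Ω → Fin m → Option (Fin n)} {x : Fin k → Ω → Fin n}

open scoped Classical in
theorem IsSample.prob_eq_expect (hs : IsSample μ κ h x)
    (P : (Fin t → Layer n m) → (Fin k → Fin n) → Prop) :
    μ.real {ω | P (fun q => h q ω) fun i => x i ω} =
      expect μ (fun ω q => h q ω) fun η => μ.real {ω | P η fun i => x i ω} := by
  have h1 := expect_indep hs.measurable_layers hs.measurable_starts hs.layers_starts_indep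
    fun η ξ => if P η ξ then (1 : ℝ) else 0
  have h2 := expect_ite (μ := μ) (hs.measurable_layers.prodMk hs.measurable_starts) (fun z => P z.1 z.2)
  rw [expect_apply (hs.measurable_layers.prodMk hs.measurable_starts)] at h2
  rw [← h2, h1]
  congr 1
  funext η
  exact expect_ite hs.measurable_starts (P η)

theorem mem_Out_of_reach {a : Fin n → Fin m} {η : Fin t → Layer n m} {i : ℕ} {w y : Fin n}
    {A : Set (Fin n)} (hA : y ∈ A) (hr : Reach a (partialHash (extend η) i) y w) :
    w ∈ Out a (combine η) A :=
  ⟨y, hA, hr.mono fun _ _ => combine_eq_some⟩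

theorem mass_add_mass_le_absorbed (R : Fin n → Fate m) :
    mass R (.inr 0) + mass R (.inr 1) ≤ absorbed R := by
  rw [mass, mass, ← avg_add]
  refine avg_mono fun c => ?_
  rcases c with r | i
  · simp
  · fin_cases i <;> simp

/-- The two targets are reached by walks from different starting points. -/
theorem IsSample.le_prob_of_pairs (hs : IsSample μ κ h x) (hn : 0 < n) (a : Fin n → Fin m)
    (u v : Fin n) (l i : ℕ) {j : ℕ} (hj : 2 * j ≤ k) :
    (j : ℝ) ^ 2 * (expect μ (fun ω q => h q ω) (fun η =>
        pairMass (fates l (initFate a u v) (.inl (a u)) (extend η) i).1 *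
          isKey (fates l (initFate a u v) (.inl (a u)) (extend η) i).2) -
      j / 2 * expect μ (fun ω q => h q ω) (fun η =>
        pairMass (fates l (initFate a u v) (.inl (a u)) (extend η) i).1 *
          absorbed (fates l (initFate a u v) (.inl (a u)) (extend η) i).1)) ≤
      μ.real {ω | u ∈ Out a (combine fun q => h q ω) (Set.range fun i => x i ω) ∧
        v ∈ Out a (combine fun q => h q ω) (Set.range fun i => x i ω)} := by
  set s : (Fin t → Layer n m) → (Fin n → Fate m) × Fate m :=
    fun η => fates l (initFate a u v) (.inl (a u)) (extend η) i with hsdef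
  have h1 := hs.prob_eq_expect fun η ξ =>
    (∃ i, (s η).1 (ξ i) = .inr 0) ∧ ∃ i, (s η).1 (ξ i) = .inr 1
  have h2 : μ.real {ω | (∃ i, (s fun q => h q ω).1 (x i ω) = .inr 0) ∧
      ∃ i, (s fun q => h q ω).1 (x i ω) = .inr 1} ≤
      μ.real {ω | u ∈ Out a (combine fun q => h q ω) (Set.range fun i => x i ω) ∧
        v ∈ Out a (combine fun q => h q ω) (Set.range fun i => x i ω)} := by
    refine measureReal_mono fun ω hω => ?_
    obtain ⟨⟨i₁, h₁⟩, ⟨i₂, h₂⟩⟩ := hω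
    have hsound := sound_fates a u v l (extend fun q => h q ω) i
    exact ⟨mem_Out_of_reach ⟨i₁, rfl⟩ ((hsound.1 _).2.1 h₁),
      mem_Out_of_reach ⟨i₂, rfl⟩ ((hsound.1 _).2.2 h₂)⟩
  refine le_trans ?_ h2
  rw [h1, ← smul_eq_mul (j / 2 : ℝ), ← map_smul, ← map_sub, ← smul_eq_mul, ← map_smul]
  refine expect_mono fun η => le_trans ?_ (hs.prob_pair hn (s η).1 hj)
  simp only [Pi.smul_apply, Pi.sub_apply, smul_eq_mul]
  have hp := pairMass_nonneg (R := (s η).1)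
  have hk : isKey (s η).2 ≤ 1 := by cases (s η).2 <;> simp [isKey]
  have hm := mass_add_mass_le_absorbed (s η).1
  refine mul_le_mul_of_nonneg_left ?_ (by positivity)
  have hj0 : (0 : ℝ) ≤ j / 2 := by positivity
  have e1 : j / 2 * (mass (s η).1 (.inr 0) + mass (s η).1 (.inr 1)) ≤
    j / 2 * absorbed (s η).1 := mul_le_mul_of_nonneg_left hm hj0
  nlinarith

open scoped Classical in
theorem IsKWise.map_exists_some {R : Fin n → Fate m} {E : (Layer n m → ℝ) →ₗ[ℝ] ℝ}
    (hE : IsKWise κ E) (hκ : 0 < κ) (r : Fin m) (c : Fate m) :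
    E (fun g => if ∃ z, g r = some z ∧ R z = c then 1 else 0) = mass R c / 2 := by
  have h1 : (fun g : Layer n m => if ∃ z, g r = some z ∧ R z = c then (1 : ℝ) else 0) =
      ∑ z, (if R z = c then (1 : ℝ) else 0) • fun g : Layer n m =>
        (1 : ℝ) * if g r = some z then 1 else 0 := by
    funext g
    simp only [Finset.sum_apply, Pi.smul_apply, smul_eq_mul, one_mul]
    cases hg : g r <;> simp
  rw [h1, map_sum]
  simp only [map_smul, hE.fresh_some ∅ r (fun _ => 1) _ (by simpa using hκ) (by simp)
    (fun _ _ _ => rfl), hE.one, smul_eq_mul, ← Finset.sum_mul, mass, avg]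
  ring

/-- The two targets are reached by one walk, whose part from the first to the second target uses a
further layer. -/
theorem IsSample.le_prob_of_single (hs : IsSample μ κ h x) (hk : 0 < k) (hκ : 0 < κ)
    (a : Fin n → Fin m) (u v : Fin n) (l : ℕ) {i : ℕ} (hi : i < t) :
    1 / 2 * expect μ (fun ω q => h q ω) (fun η =>
        pairMass (fates l (initFate a u v) (.inl (a u)) (extend η) i).1 *
          isKey (fates l (initFate a u v) (.inl (a u)) (extend η) i).2) ≤
      μ.real {ω | u ∈ Out a (combine fun q => h q ω) (Set.range fun i => x i ω) ∧
        v ∈ Out a (combine fun q => h q ω) (Set.range fun i => x i ω)} := by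
  classical
  set s : (Fin t → Layer n m) → (Fin n → Fate m) × Fate m :=
    fun η => fates l (initFate a u v) (.inl (a u)) (extend η) i with hsdef
  let P : (Fin n → Fate m) × Fate m → Layer n m → Prop := fun σ g =>
    ∃ r, σ.2 = .inl r ∧ ∃ z, g r = some z ∧ σ.1 z = .inr 1
  have h1 := hs.prob_eq_expect fun η ξ => P (s η) (η ⟨i, hi⟩) ∧ (s η).1 (ξ ⟨0, hk⟩) = .inr 0
  have h2 : μ.real {ω | P (s fun q => h q ω) (h ⟨i, hi⟩ ω) ∧
      (s fun q => h q ω).1 (x ⟨0, hk⟩ ω) = .inr 0} ≤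
      μ.real {ω | u ∈ Out a (combine fun q => h q ω) (Set.range fun i => x i ω) ∧
        v ∈ Out a (combine fun q => h q ω) (Set.range fun i => x i ω)} := by
    refine measureReal_mono fun ω hω => ?_
    obtain ⟨⟨r, hr, z, hz, hzv⟩, hx⟩ := hω
    have hsound := sound_fates a u v l (extend fun q => h q ω) i
    have hmono : ∀ r y, partialHash (extend fun q => h q ω) i r = some y →
        partialHash (extend fun q => h q ω) (i + 1) r = some y := fun r y h => by
      simp [partialHash, h]
    have hxu := ((hsound.1 _).2.1 hx).mono hmono
    have hzv' := ((hsound.1 _).2.2 hzv).mono hmono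
    obtain ⟨hnone, y, huy, hy⟩ := hsound.2.1 r hr
    have huz : Reach a (partialHash (extend fun q => h q ω) (i + 1)) u z := by
      refine (huy.mono hmono).tail ?_
      simp [graph, hy, partialHash, hnone, extend, hi, hz]
    exact ⟨mem_Out_of_reach ⟨_, rfl⟩ hxu, mem_Out_of_reach ⟨_, rfl⟩ ((hxu.trans huz).trans hzv')⟩
  refine le_trans (le_of_eq ?_) h2
  rw [h1]
  have h3 : ∀ η, μ.real {ω | P (s η) (η ⟨i, hi⟩) ∧ (s η).1 (x ⟨0, hk⟩ ω) = .inr 0} =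
      mass (s η).1 (.inr 0) * if P (s η) (η ⟨i, hi⟩) then 1 else 0 := fun η => by
    by_cases hP : P (s η) (η ⟨i, hi⟩)
    · simp [hP, hs.prob_fate]
    · simp [hP]
  simp only [h3]
  have h4 := expect_fates_layer (fun q => (hs.layer q).measurable) hs.layers_indep l
    (initFate a u v) (.inl (a u)) ⟨i, hi⟩
    fun σ g => mass σ.1 (.inr 0) * if P σ g then 1 else 0
  refine Eq.trans ?_ h4.symm
  rw [← smul_eq_mul, ← map_smul]
  congr 1
  funext η
  simp only [Pi.smul_apply, smul_eq_mul]
  have hE := (hs.layer ⟨i, hi⟩).isKWise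
  have h5 : ∀ σ, expect μ (h ⟨i, hi⟩) (fun g => if P σ g then (1 : ℝ) else 0) =
      isKey σ.2 * (mass σ.1 (.inr 1) / 2) := by
    rintro ⟨R, r | j⟩
    · rw [← hE.map_exists_some hκ r]
      simp [P, isKey]
    · have : ∀ g, ¬ P (R, .inr j) g := fun g => by simp [P]
      simp only [this, if_false, isKey, Sum.elim_inr, zero_mul]
      exact map_zero _
  have h6 := (expect μ (h ⟨i, hi⟩)).map_smul (mass (s η).1 (.inr 0))
    (fun g => if P (s η) g then (1 : ℝ) else 0)
  refine Eq.trans ?_ h6.symm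
  rw [h5, pairMass, smul_eq_mul]
  ring

end Assembly

/-- The number of layers used in the argument. -/
theorem exists_layer_number {K V : ℝ} (hK : 0 < K) (hV : 0 < V) :
    ∃ s : ℕ, (s = 0 ∨ K * 4 ^ s * V ≤ 1 / 64) ∧ 1 / 64 < K * 4 ^ (s + 1) * V := by
  classical
  have hex : ∃ s : ℕ, 1 / 64 < K * 4 ^ (s + 1) * V := by
    obtain ⟨s, hs⟩ := pow_unbounded_of_one_lt (1 / 64 / (K * V)) (by norm_num : (1 : ℝ) < 4)
    refine ⟨s, ?_⟩
    rw [div_lt_iff₀ (by positivity)] at hs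
    rw [pow_succ]
    have : (0 : ℝ) < 4 ^ s * (K * V) := by positivity
    linarith
  refine ⟨Nat.find hex, ?_, Nat.find_spec hex⟩
  rcases hs : Nat.find hex with _ | s
  · exact Or.inl rfl
  · exact Or.inr (not_lt.1 (Nat.find_min hex (by omega : s < Nat.find hex)))

theorem lt_mul_four_pow {n k t : ℕ} (hk : 1 ≤ k) (hn : 0 < n)
    (ht : |(t : ℝ) - 1 / 2 * Real.logb 2 ((n : ℝ) / (k : ℝ))| < 1) :
    (n : ℝ) < k * 4 ^ (t + 1) := by
  have hk' : (0 : ℝ) < k := by exact_mod_cast hk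
  have hn' : (0 : ℝ) < n := by exact_mod_cast hn
  have h1 : Real.logb 2 ((n : ℝ) / k) < ((2 * (t + 1) : ℕ) : ℝ) := by
    push_cast
    linarith [(abs_lt.1 ht).1]
  rw [Real.logb_lt_iff_lt_rpow (by norm_num) (by positivity), Real.rpow_natCast, pow_mul,
    div_lt_iff₀ hk'] at h1
  norm_num at h1
  linarith

theorem half_pow_le {n κ : ℕ} (hn : 2 ≤ n) (hκ : |(κ : ℝ) - 20 * Real.logb 2 (n : ℝ)| < 1) :
    (1 / 2 : ℝ) ^ (κ / 4) ≤ 1 / n ∧ 0 < κ := by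
  have hn' : (0 : ℝ) < n := by exact_mod_cast (by omega : 0 < n)
  have hlog : 1 ≤ Real.logb 2 (n : ℝ) := by
    rw [Real.le_logb_iff_rpow_le (by norm_num) hn']
    simpa using (by exact_mod_cast hn : (2 : ℝ) ≤ n)
  have h1 := (abs_lt.1 hκ).1
  have h2 : (κ : ℝ) ≤ 4 * (κ / 4 : ℕ) + 3 := by exact_mod_cast (by omega : κ ≤ 4 * (κ / 4) + 3)
  have h3 : Real.logb 2 (n : ℝ) ≤ (κ / 4 : ℕ) := by linarith
  rw [Real.logb_le_iff_le_rpow (by norm_num) hn', Real.rpow_natCast] at h3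
  refine ⟨?_, ?_⟩
  · rw [one_div_pow]
    exact one_div_le_one_div_of_le hn' h3
  · have : (0 : ℝ) < κ := by linarith
    exact_mod_cast this

section Conclusion

variable {Ω : Type*} [MeasurableSpace Ω] {μ : Measure Ω} [IsProbabilityMeasure μ]
  {n m t k κ : ℕ} {h : Fin t → Ω → Fin m → Option (Fin n)} {x : Fin k → Ω → Fin n}

/-- The moments after the number of layers given by `exists_layer_number`. -/
theorem IsSample.moments_at (hs : IsSample μ κ h x) (hn : 2 ≤ n) (hk : 1 ≤ k) (a : Fin n → Fin m)
    {u v : Fin n} (huv : u ≠ v) {l : ℕ} (hl : 4 * l ≤ κ) (hln : (1 / 2 : ℝ) ^ l ≤ 1 / n)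
    {s : ℕ} (hst : s ≤ t)
    (hsV : s = 0 ∨ (k : ℝ) * 4 ^ s * ((F2 a : ℝ) / (n : ℝ) ^ 2) ≤ 1 / 64) {j : ℕ} (hj : 2 * j ≤ k)
    (hkn : k ≤ n) :
    1 / 2 * (4 ^ s / (n : ℝ) ^ 2) ≤ expect μ (fun ω q => h q ω) (fun η =>
        pairMass (fates l (initFate a u v) (.inl (a u)) (extend η) s).1 *
          isKey (fates l (initFate a u v) (.inl (a u)) (extend η) s).2) ∧
    1 / 4 * (4 ^ s / (n : ℝ) ^ 2) ≤ expect μ (fun ω q => h q ω) (fun η =>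
        pairMass (fates l (initFate a u v) (.inl (a u)) (extend η) s).1 *
          isKey (fates l (initFate a u v) (.inl (a u)) (extend η) s).2) -
      j / 2 * expect μ (fun ω q => h q ω) (fun η =>
        pairMass (fates l (initFate a u v) (.inl (a u)) (extend η) s).1 *
          absorbed (fates l (initFate a u v) (.inl (a u)) (extend η) s).1) := by
  have hn' : (0 : ℝ) < n := by exact_mod_cast (by omega : 0 < n)
  have hk' : (1 : ℝ) ≤ k := by exact_mod_cast hk
  have hjk : 2 * (j : ℝ) ≤ k := by exact_mod_cast hj
  have hkn' : (k : ℝ) ≤ n := by exact_mod_cast hkn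
  rcases hsV with rfl | hsV
  · simp only [fates, expect_const hs.measurable_layers, pairMass_initFate huv,
      absorbed_initFate huv, isKey, Sum.elim_inl, pow_zero, mul_one]
    have hN : 0 < 1 / (n : ℝ) ^ 2 := by positivity
    refine ⟨by linarith, ?_⟩
    have : (j : ℝ) / 2 * (1 / (n : ℝ) ^ 2 * (2 / n)) = 1 / (n : ℝ) ^ 2 * (j / n) := by ring
    rw [this]
    have : (j : ℝ) / n ≤ 1 / 2 := by rw [div_le_iff₀ hn']; linarith
    nlinarith
  · obtain ⟨hB, hΦ⟩ := hs.fates_moments (by omega) a huv hl hln hst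
    set V := (F2 a : ℝ) / (n : ℝ) ^ 2 with hV
    have hV0 : 0 ≤ V := by positivity
    have h4V : (4 : ℝ) ^ s * V ≤ 1 / 64 := by
      have : 0 ≤ (4 : ℝ) ^ s * V := by positivity
      nlinarith
    have h2V : (2 : ℝ) ^ s * √V ≤ 1 / 8 := by
      refine abs_le_of_sq_le_sq' ?_ (by norm_num) |>.2
      rw [mul_pow, Real.sq_sqrt hV0, ← pow_mul, mul_comm s 2, pow_mul]
      norm_num
      linarith
    have hc : (0 : ℝ) ≤ 4 ^ s / (n : ℝ) ^ 2 := by positivity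
    have e1 : 1 / (n : ℝ) ^ 2 * (4 ^ s * (1 - 8 * 4 ^ s * V - 3 * 2 ^ s * √V)) =
        4 ^ s / (n : ℝ) ^ 2 * (1 - 8 * (4 ^ s * V) - 3 * (2 ^ s * √V)) := by ring
    have e2 : 1 / (n : ℝ) ^ 2 * (4 * (4 ^ s * 4 ^ s) * V) =
        4 ^ s / (n : ℝ) ^ 2 * (4 * (4 ^ s * V)) := by ring
    rw [e1] at hΦ
    rw [e2] at hB
    have hΦ' : 1 / 2 * (4 ^ s / (n : ℝ) ^ 2) ≤
        4 ^ s / (n : ℝ) ^ 2 * (1 - 8 * (4 ^ s * V) - 3 * (2 ^ s * √V)) := by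
      rw [mul_comm]
      exact mul_le_mul_of_nonneg_left (by linarith) hc
    refine ⟨hΦ'.trans hΦ, ?_⟩
    have hB' := mul_le_mul_of_nonneg_left hB (by positivity : (0 : ℝ) ≤ j / 2)
    have hB'' : (j : ℝ) / 2 * (4 ^ s / (n : ℝ) ^ 2 * (4 * (4 ^ s * V))) ≤
        1 / 64 * (4 ^ s / (n : ℝ) ^ 2) := by
      have h0 : 0 ≤ (4 : ℝ) ^ s * V := by positivity
      have : (j : ℝ) / 2 * (4 ^ s / (n : ℝ) ^ 2 * (4 * (4 ^ s * V))) =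
        4 ^ s / (n : ℝ) ^ 2 * (2 * j * (4 ^ s * V)) := by ring
      rw [this, mul_comm (1 / 64 : ℝ)]
      refine mul_le_mul_of_nonneg_left ?_ hc
      calc 2 * (j : ℝ) * (4 ^ s * V) ≤ k * (4 ^ s * V) := mul_le_mul_of_nonneg_right hjk h0
        _ ≤ 1 / 64 := by linarith
    linarith

theorem IsSample.le_prob (hs : IsSample μ κ h x) (hk : 1 ≤ k) (hkn : k ≤ n)
    (ht : |(t : ℝ) - 1 / 2 * Real.logb 2 ((n : ℝ) / (k : ℝ))| < 1) (ht1 : k = 1 → 1 ≤ t)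
    (hκ : |(κ : ℝ) - 20 * Real.logb 2 (n : ℝ)| < 1) (a : Fin n → Fin m) {u v : Fin n}
    (huv : u ≠ v) :
    1 / 10000 * ((k : ℝ) / (F2 a : ℝ)) ≤
      μ.real {ω | u ∈ Out a (combine fun q => h q ω) (Set.range fun i => x i ω) ∧
        v ∈ Out a (combine fun q => h q ω) (Set.range fun i => x i ω)} := by
  have hn : 2 ≤ n := by
    have h1 := u.2
    have h2 := v.2
    have h3 : u.1 ≠ v.1 := fun h => huv (Fin.ext h)
    omega
  have hn' : (0 : ℝ) < n := by exact_mod_cast (by omega : 0 < n)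
  have hk' : (1 : ℝ) ≤ k := by exact_mod_cast hk
  have hF : (n : ℝ) ≤ F2 a := by exact_mod_cast le_F2 a
  have hF0 : (0 : ℝ) < F2 a := by linarith
  obtain ⟨hln, hκ0⟩ := half_pow_le hn hκ
  obtain ⟨s, hs1, hs2⟩ := exists_layer_number (K := k) (V := (F2 a : ℝ) / (n : ℝ) ^ 2)
    (by linarith) (by positivity)
  have hlt : s = 0 ∨ s < t := by
    refine hs1.imp_right fun hsV => ?_
    have h1 := lt_mul_four_pow hk (by omega) ht
    have h2 : 1 / (n : ℝ) ≤ (F2 a : ℝ) / (n : ℝ) ^ 2 := by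
      rw [div_le_div_iff₀ hn' (by positivity), one_mul, sq]
      gcongr
    have h3 : (k : ℝ) * 4 ^ s * (1 / n) ≤ 1 / 64 :=
      (mul_le_mul_of_nonneg_left h2 (by positivity)).trans hsV
    rw [mul_one_div, div_le_iff₀ hn'] at h3
    have h4 : (k : ℝ) * 4 ^ s < k * 4 ^ t := by
      rw [pow_succ] at h1
      have : 0 < (k : ℝ) * 4 ^ t := by positivity
      linarith
    exact (pow_lt_pow_iff_right₀ (by norm_num : (1 : ℝ) < 4)).1 (lt_of_mul_lt_mul_left h4 (by linarith))
  have hmain : (k : ℝ) / F2 a / 256 * (1 / k ^ 2) ≤ 4 ^ s / (n : ℝ) ^ 2 := by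
    rw [pow_succ] at hs2
    have e : (k : ℝ) * (4 ^ s * 4) * (F2 a / (n : ℝ) ^ 2) =
        (4 ^ s / (n : ℝ) ^ 2) * (4 * k * F2 a) := by ring
    rw [e, ← div_lt_iff₀ (by positivity)] at hs2
    refine le_trans (le_of_eq ?_) hs2.le
    field_simp
    norm_num
  have hkF : 0 ≤ (k : ℝ) / F2 a := by positivity
  by_cases hk1 : k = 1
  · have hst : s < t := by
      rcases hlt with rfl | h
      · exact ht1 hk1
      · exact h
    have hmom := (hs.moments_at hn hk a huv (l := κ / 4) (by omega) hln hst.le hs1 (j := 0)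
      (by omega) hkn).1
    refine le_trans ?_ (hs.le_prob_of_single (by omega) hκ0 a u v (κ / 4) hst)
    subst hk1
    norm_num at hmain ⊢
    have hF1 : 0 ≤ (F2 a : ℝ)⁻¹ := by positivity
    linarith
  · have hst : s ≤ t := by rcases hlt with rfl | h <;> omega
    have hmom := (hs.moments_at hn hk a huv (l := κ / 4) (by omega) hln hst hs1 (j := k / 2)
      (by omega) hkn).2
    refine le_trans ?_ (hs.le_prob_of_pairs (by omega) a u v (κ / 4) s (j := k / 2) (by omega))
    have hj : (k : ℝ) ≤ 3 * (k / 2 : ℕ) := by exact_mod_cast (by omega : k ≤ 3 * (k / 2))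
    have hj2 : (k : ℝ) ^ 2 / 9 ≤ ((k / 2 : ℕ) : ℝ) ^ 2 := by nlinarith
    calc 1 / 10000 * ((k : ℝ) / (F2 a : ℝ))
        ≤ k ^ 2 / 9 * (1 / 4 * ((k : ℝ) / F2 a / 256 * (1 / k ^ 2))) := by
          have : (k : ℝ) ^ 2 / 9 * (1 / 4 * ((k : ℝ) / F2 a / 256 * (1 / k ^ 2))) =
            1 / 9216 * (k / F2 a) := by
            field_simp
            norm_num
          rw [this]
          exact mul_le_mul_of_nonneg_right (by norm_num) hkF
      _ ≤ _ := by
          refine mul_le_mul hj2 (le_trans ?_ hmom) (by positivity) (by positivity)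
          exact mul_le_mul_of_nonneg_left hmain (by norm_num)

end Conclusion
end LayeredHash

theorem mainTheorem5 :
    ∃ c : ℝ, 0 < c ∧
      ∀ (n m k t κ : ℕ), 1 ≤ k → k ≤ n →
        |(t : ℝ) - 1 / 2 * Real.logb 2 ((n : ℝ) / (k : ℝ))| < 1 →
        (k = 1 → 1 ≤ t) →
        |(κ : ℝ) - 20 * Real.logb 2 (n : ℝ)| < 1 →
        ∀ (Ω : Type*) [MeasurableSpace Ω] (μ : Measure Ω) [IsProbabilityMeasure μ]
          (h : Fin t → Ω → Fin m → Option (Fin n)) (x : Fin k → Ω → Fin n),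
          LayeredHash.IsSample μ κ h x →
          ∀ (a : Fin n → Fin m) (u v : Fin n), u ≠ v →
            c * ((k : ℝ) / (LayeredHash.F2 a : ℝ)) ≤
              μ.real {ω |
                u ∈ LayeredHash.Out a (LayeredHash.combine fun i => h i ω)
                  (Set.range fun i => x i ω) ∧
                v ∈ LayeredHash.Out a (LayeredHash.combine fun i => h i ω)
                  (Set.range fun i => x i ω)} := by
  refine ⟨1 / 10000, by norm_num, ?_⟩
  intro n m k t κ hk hkn ht ht1 hκ Ω _ μ _ h x hs a u v huv
  exact hs.le_prob hk hkn ht ht1 hκ a huv
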